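/- Topological groups are Hausdorff; t.d.l.c. means totally disconnected locally compact. A t.d.l.c. group $G$ is regionally expansive if some compactly generated open subgroup $O$ has a compact open subgroup whose normal core in $O$ is trivial. The monolith $\mathrm{Mon}(G)$ is the intersection of all non-trivial closed normal subgroups of $G$, and $G$ is monolithic if $\mathrm{Mon}(G)\neq 1$. Let $\mathscr R$ be the class of robustly monolithic groups, i.e. monolithic t.d.l.c. groups whose monolith is non-discrete, regionally expansive and topologically simple. For a set of primes $\pi$, $G$ is locally pro-$\pi$ if it has an open pro-$\pi$ subgroup. The local prime content $\eta(G)$ is the set of primes $p$ such that $G$ has an infinite pro-$p$ subgroup. A dense locally compact subgroup of $G$ is a locally compact group $H$ with a dense embedding, i.e. a continuous injective homomorphism $\psi\colon H\to G$ with dense image. For a closed subgroup $S\le G$, the localization $G_{(S)}$ is the commensurator $\mathrm{Comm}_G(S)$ with the unique group topology making the inclusion of $S$ continuous and open. The $p$-localization $G_{(p)}$ is $G_{(S)}$ for $S$ any pro-$p$-Sylow subgroup of any compact open subgroup of $G$; the assertions about $G_{(p)}$ below hold for every such choice. **Theorem.** (1) Let $G$ be a regionally expansive t.d.l.c. group.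 Then $\eta(G)$ is finite and $G$ is locally pro-$\eta(G)$. For each $p\in\eta(G)$ and each compact open subgroup $U\le G$, the group $U$ has an infinite pro-$p$ subgroup and a pro-$p$-Sylow subgroup, and $G_{(p)}$ is non-discrete. (2) Let $G\in\mathscr R$. Then: (a) $\eta(G)$ is finite and $G$ is locally pro-$\eta(G)$. (b) For each $p\in\eta(G)$, every compact open subgroup of $G$ has a pro-$p$-Sylow subgroup, and the $p$-localization $G_{(p)}$, with its inclusion into $G$, is a non-discrete, locally pro-$p$, dense locally compact subgroup of $G$ that lies in $\mathscr R$. (c) $\eta(G)$ is the unique finite set of primes $\pi$ such that $G$ is locally pro-$\pi$ and, for each $p\in\pi$, $G$ has a non-discrete locally pro-$p$ dense locally compact subgroup. (d) Let $p\in\eta(G)$. Every non-discrete locally pro-$p$ dense locally compact subgroup $\psi\colon H\to G$ (in particular $H=G_{(p)}$) belongs to $\mathscr R$, and $\psi$ restricts to a dense embedding of $\mathrm{Mon}(H)$ into $\mathrm{Mon}(G)$, where $\mathrm{Mon}(H)$ is non-discrete, topologically simple and locally pro-$p$. (e) If $G$ is moreover topologically simple, then for each $p\in\eta(G)$ it has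 a non-discrete, topologically simple, locally pro-$p$ dense locally compact subgroup. -/

import Mathlib

open scoped Topology Pointwise

universe u v

namespace TDLC

/-- Totally disconnected locally compact (Hausdorff) topological groups. -/
structure IsTDLC (G : Type u) [Group G] [TopologicalSpace G] : Prop where
  isTopologicalGroup : IsTopologicalGroup G
  t2Space : T2Space G
  locallyCompactSpace : LocallyCompactSpace G
  totallyDisconnectedSpace : TotallyDisconnectedSpace G

/-- A topological group is compactly generated if some compact subset generates it
as an abstract group. -/
def IsCompactlyGeneratedGroup (G : Type u) [Group G] [TopologicalSpace G] : Prop :=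
  ∃ C : Set G, IsCompact C ∧ Subgroup.closure C = ⊤

/-- Some compactly generated open subgroup `O` has a compact open subgroup `W` whose normal core
in `O` is trivial. -/
def IsRegionallyExpansive (G : Type u) [Group G] [TopologicalSpace G] : Prop :=
  ∃ O : Subgroup G, IsOpen (O : Set G) ∧ IsCompactlyGeneratedGroup O ∧
    ∃ W : Subgroup O, IsOpen (W : Set O) ∧ IsCompact (W : Set O) ∧ W.normalCore = ⊥

/-- The intersection of all non-trivial closed normal subgroups. -/
def monolith (G : Type u) [Group G] [TopologicalSpace G] : Subgroup G :=
  sInf {N : Subgroup G | N ≠ ⊥ ∧ N.Normal ∧ IsClosed (N : Set G)}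

/-- The intersection of all non-trivial closed normal subgroups is non-trivial. (For the trivial
group this is the empty intersection, i.e. the whole group, so that the trivial group is not
monolithic.) -/
def IsMonolithic (G : Type u) [Group G] [TopologicalSpace G] : Prop :=
  monolith G ≠ ⊥

/-- A non-trivial topological group whose only closed normal subgroups are the trivial one and the
whole group. -/
def IsTopologicallySimple (G : Type u) [Group G] [TopologicalSpace G] : Prop :=
  Nontrivial G ∧ ∀ N : Subgroup G, N.Normal → IsClosed (N : Set G) → N = ⊥ ∨ N = ⊤

/-- The class of robustly monolithic groups: monolithic t.d.l.c. groups whose monolith is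
non-discrete, regionally expansive and topologically simple. -/
structure IsRobustlyMonolithic (G : Type u) [Group G] [TopologicalSpace G] : Prop where
  isTDLC : IsTDLC G
  isMonolithic : IsMonolithic G
  not_discrete : ¬ DiscreteTopology (monolith G)
  isRegionallyExpansive : IsRegionallyExpansive (monolith G)
  isTopologicallySimple : IsTopologicallySimple (monolith G)

/-- Pro-`π` groups: profinite groups such that every prime divisor of the index of an open normal
subgroup belongs to `π`. (Open subgroups of a compact group have finite index.) -/
structure IsProPi (π : Set ℕ) (P : Type u) [Group P] [TopologicalSpace P] : Prop where
  isTopologicalGroup : IsTopologicalGroup P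
  t2Space : T2Space P
  compactSpace : CompactSpace P
  totallyDisconnectedSpace : TotallyDisconnectedSpace P
  index_mem : ∀ N : Subgroup P, N.Normal → IsOpen (N : Set P) →
    ∀ q : ℕ, q.Prime → q ∣ N.index → q ∈ π

/-- `G` has an open pro-`π` subgroup. -/
def IsLocallyProPi (π : Set ℕ) (G : Type u) [Group G] [TopologicalSpace G] : Prop :=
  ∃ U : Subgroup G, IsOpen (U : Set G) ∧ IsProPi π U

/-- The local prime content `η(G)`: all primes `p` such that `G` has an infinite pro-`p`
subgroup. -/
def localPrimeContent (G : Type u) [Group G] [TopologicalSpace G] : Set ℕ :=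
  {p | p.Prime ∧ ∃ P : Subgroup G, Infinite P ∧ IsProPi {p} P}

/-- `S` is a pro-`p`-Sylow subgroup of `U`, i.e. maximal among the pro-`p` subgroups of `U`
(which are compact by definition, hence closed). -/
def IsProPSylow {G : Type u} [Group G] [TopologicalSpace G] (p : ℕ) (U S : Subgroup G) : Prop :=
  S ≤ U ∧ IsProPi {p} S ∧ ∀ T : Subgroup G, T ≤ U → IsProPi {p} T → S ≤ T → T = S

/-- `ψ` is a dense embedding of the locally compact (Hausdorff) group `H` into `G`: a continuous
injective homomorphism with dense image, not necessarily a homeomorphism onto its image. Then `H`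
is said to be a dense locally compact subgroup of `G`. -/
structure IsDenseGroupEmbedding {H : Type v} {G : Type u} [Group H] [TopologicalSpace H]
    [Group G] [TopologicalSpace G] (ψ : H →* G) : Prop where
  isTopologicalGroup : IsTopologicalGroup H
  t2Space : T2Space H
  locallyCompactSpace : LocallyCompactSpace H
  continuous : Continuous ψ
  injective : Function.Injective ψ
  denseRange : DenseRange ψ

/-- Along `ψ : H → G`, the monolith of `H` is a non-discrete topologically simple locally pro-`p`
dense locally compact subgroup of the monolith of `G`. -/
def MonolithIsSimpleDenseProP {H : Type v} {G : Type u} [Group H] [TopologicalSpace H]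
    [Group G] [TopologicalSpace G] (p : ℕ) (ψ : H →* G) : Prop :=
  ¬ DiscreteTopology (monolith H) ∧ IsTopologicallySimple (monolith H) ∧
    IsLocallyProPi {p} (monolith H) ∧
    ∃ φ : monolith H →* monolith G, (∀ x, (φ x : G) = ψ x) ∧ IsDenseGroupEmbedding φ

section Localization

variable {G : Type u} [Group G]

/-- The localization `G_(K)` of `G` at a subgroup `K`: the commensurator of `K` in `G`, endowed
with the `K`-localized topology below (and not with the subspace topology). -/
def LocalizedAt (K : Subgroup G) : Type u :=
  Subgroup.Commensurable.commensurator K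

noncomputable instance (K : Subgroup G) : Group (LocalizedAt K) :=
  inferInstanceAs (Group (Subgroup.Commensurable.commensurator K))

/-- The inclusion of the localization into the ambient group. -/
def LocalizedAt.incl (K : Subgroup G) : LocalizedAt K →* G :=
  (Subgroup.Commensurable.commensurator K).subtype

/-- The `K`-localized topology: a set is open iff together with a point `g` it contains
`g (K ∩ W)` for some identity neighbourhood `W` of `G`. For compact `K` it is the unique group
topology on the commensurator for which the inclusion of `K` is continuous and open; see
`LocalizedAt.isTopologicalGroup`, `LocalizedAt.isOpenEmbedding_ofSubgroup` and
`LocalizedAt.topology_unique`. -/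
instance LocalizedAt.topology [TopologicalSpace G] (K : Subgroup G) :
    TopologicalSpace (LocalizedAt K) where
  IsOpen V := ∀ g ∈ V, ∃ W ∈ 𝓝 (1 : G), ∀ x : LocalizedAt K,
    LocalizedAt.incl K x ∈ K → LocalizedAt.incl K x ∈ W → g * x ∈ V
  isOpen_univ := fun _ _ => ⟨Set.univ, Filter.univ_mem, fun _ _ _ => trivial⟩
  isOpen_inter := by
    intro s t hs ht g hg
    obtain ⟨W, hW, h⟩ := hs g hg.1
    obtain ⟨W', hW', h'⟩ := ht g hg.2
    exact ⟨W ∩ W', Filter.inter_mem hW hW', fun x hx hxW => ⟨h x hx hxW.1, h' x hx hxW.2⟩⟩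
  isOpen_sUnion := by
    intro s hs g ⟨t, hts, hgt⟩
    obtain ⟨W, hW, h⟩ := hs t hts g hgt
    exact ⟨W, hW, fun x hx hxW => ⟨t, hts, h x hx hxW⟩⟩

theorem le_commensurator (K : Subgroup G) : K ≤ Subgroup.Commensurable.commensurator K := by
  intro k hk
  rw [Subgroup.Commensurable.commensurator_mem_iff]
  have h : ConjAct.toConjAct k • K = K := Subgroup.conj_smul_eq_self_of_mem hk
  rw [h]

/-- The inclusion of `K` into the localization at `K`. -/
def LocalizedAt.ofSubgroup (K : Subgroup G) : K →* LocalizedAt K :=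
  Subgroup.inclusion (le_commensurator K)

theorem LocalizedAt.incl_ofSubgroup (K : Subgroup G) (k : K) :
    LocalizedAt.incl K (LocalizedAt.ofSubgroup K k) = k := rfl

theorem LocalizedAt.incl_injective (K : Subgroup G) : Function.Injective (LocalizedAt.incl K) :=
  Subtype.val_injective

variable [TopologicalSpace G]

theorem LocalizedAt.isOpen_iff {K : Subgroup G} {V : Set (LocalizedAt K)} :
    IsOpen V ↔ ∀ g ∈ V, ∃ W ∈ 𝓝 (1 : G), ∀ x : LocalizedAt K,
      LocalizedAt.incl K x ∈ K → LocalizedAt.incl K x ∈ W → g * x ∈ V := Iff.rfl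

theorem LocalizedAt.mem_nhds_one [IsTopologicalGroup G] {K : Subgroup G}
    {V : Set (LocalizedAt K)} :
    V ∈ 𝓝 1 ↔ ∃ W ∈ 𝓝 (1 : G), ∀ x : LocalizedAt K,
      LocalizedAt.incl K x ∈ K → LocalizedAt.incl K x ∈ W → x ∈ V := by
  rw [mem_nhds_iff]
  constructor
  · rintro ⟨t, htV, ht, h1⟩
    obtain ⟨W, hW, h⟩ := ht 1 h1
    exact ⟨W, hW, fun x hx hxW => htV (by simpa using h x hx hxW)⟩
  · rintro ⟨W, hW, h⟩
    obtain ⟨W', hW'W, hW', h1⟩ := mem_nhds_iff.1 hW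
    refine ⟨{x | LocalizedAt.incl K x ∈ K ∧ LocalizedAt.incl K x ∈ W'},
      fun x hx => h x hx.1 (hW'W hx.2), ?_, by simp [h1, K.one_mem]⟩
    intro g hg
    refine ⟨(fun y => LocalizedAt.incl K g * y) ⁻¹' W', ?_, fun x hx hxW => ?_⟩
    · exact (hW'.preimage (continuous_const_mul _)).mem_nhds (by simpa using hg.2)
    · exact ⟨by simpa using K.mul_mem hg.1 hx, by simpa using hxW⟩

theorem LocalizedAt.continuous_incl [IsTopologicalGroup G] (K : Subgroup G) :
    Continuous (LocalizedAt.incl K) := by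
  refine ⟨fun V hV => LocalizedAt.isOpen_iff.2 fun g hg => ?_⟩
  refine ⟨(fun y => LocalizedAt.incl K g * y) ⁻¹' V, ?_, fun x _ hxW => by simpa using hxW⟩
  exact (hV.preimage (continuous_const_mul _)).mem_nhds (by simpa using hg)

theorem LocalizedAt.isOpenEmbedding_ofSubgroup [IsTopologicalGroup G] (K : Subgroup G) :
    Topology.IsOpenEmbedding (LocalizedAt.ofSubgroup K) := by
  refine Topology.IsOpenEmbedding.of_continuous_injective_isOpenMap ⟨fun V hV => ?_⟩
    (Subgroup.inclusion_injective _) fun V hV => ?_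
  · rw [isOpen_iff_mem_nhds]
    intro k hk
    obtain ⟨W, hW, h⟩ := LocalizedAt.isOpen_iff.1 hV _ hk
    have hc : Filter.Tendsto (fun y : K => ((k⁻¹ * y : K) : G)) (𝓝 k) (𝓝 1) := by
      have : Continuous (fun y : K => ((k⁻¹ * y : K) : G)) := by fun_prop
      simpa using this.tendsto k
    filter_upwards [hc hW] with y hy
    have := h (LocalizedAt.ofSubgroup K (k⁻¹ * y)) (SetLike.coe_mem (k⁻¹ * y)) hy
    rwa [← map_mul, mul_inv_cancel_left] at this
  · rintro _ ⟨k, hk, rfl⟩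
    obtain ⟨V', hV', rfl⟩ := isOpen_induced_iff.1 hV
    refine ⟨(fun y => (k : G) * y) ⁻¹' V', ?_, fun x hx hxW => ?_⟩
    · exact (hV'.preimage (continuous_const_mul _)).mem_nhds (by simpa using hk)
    · exact ⟨k * ⟨LocalizedAt.incl K x, hx⟩, hxW, rfl⟩

theorem LocalizedAt.isTopologicalGroup [IsTopologicalGroup G] {K : Subgroup G}
    (hK : IsClosed (K : Set G)) : IsTopologicalGroup (LocalizedAt K) := by
  refine IsTopologicalGroup.of_nhds_one ?_ ?_ (fun g => ?_) (fun g V hV => ?_)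
  · intro V hV
    obtain ⟨W, hW, h⟩ := LocalizedAt.mem_nhds_one.1 hV
    obtain ⟨W', hW'o, h1, hW'⟩ := exists_open_nhds_one_mul_subset hW
    have hN : {x : LocalizedAt K | LocalizedAt.incl K x ∈ K ∧ LocalizedAt.incl K x ∈ W'} ∈ 𝓝 1 :=
      LocalizedAt.mem_nhds_one.2 ⟨W', hW'o.mem_nhds h1, fun x hx hxW => ⟨hx, hxW⟩⟩
    refine Filter.mem_map.2 (Filter.mem_of_superset (Filter.prod_mem_prod hN hN) ?_)
    rintro ⟨x, y⟩ ⟨hx, hy⟩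
    refine h (x * y) ?_ ?_
    · simpa using K.mul_mem hx.1 hy.1
    · simpa using hW' (Set.mul_mem_mul hx.2 hy.2)
  · intro V hV
    obtain ⟨W, hW, h⟩ := LocalizedAt.mem_nhds_one.1 hV
    refine Filter.mem_map.2 (LocalizedAt.mem_nhds_one.2 ⟨W⁻¹, inv_mem_nhds_one G hW,
      fun x hx hxW => h x⁻¹ ?_ ?_⟩)
    · simpa using hx
    · simpa using hxW
  · have hl : ∀ a : LocalizedAt K, Continuous (fun x => a * x) := by
      refine fun a => ⟨fun V hV => LocalizedAt.isOpen_iff.2 fun x hx => ?_⟩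
      obtain ⟨W, hW, h⟩ := LocalizedAt.isOpen_iff.1 hV _ hx
      exact ⟨W, hW, fun y hy hyW => by simpa [mul_assoc] using h y hy hyW⟩
    let e : LocalizedAt K ≃ₜ LocalizedAt K :=
      { Equiv.mulLeft g with
        continuous_toFun := hl g
        continuous_invFun := hl g⁻¹ }
    have := e.map_nhds_eq 1
    have h1 : e 1 = g := mul_one g
    rw [h1] at this
    exact this.symm
  · obtain ⟨W, hW, h⟩ := LocalizedAt.mem_nhds_one.1 hV
    set a := LocalizedAt.incl K g with ha
    have hmem : a⁻¹ ∈ Subgroup.Commensurable.commensurator K :=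
      (Subgroup.Commensurable.commensurator K).inv_mem g.2
    have hL : ConjAct.toConjAct a⁻¹ • K = K.comap (MulAut.conj a).toMonoidHom := by
      ext x
      rw [Subgroup.mem_pointwise_smul_iff_inv_smul_mem]
      simp [ConjAct.smul_def]
    rw [Subgroup.Commensurable.commensurator_mem_iff, hL] at hmem
    have hfin : ((K.comap (MulAut.conj a).toMonoidHom).subgroupOf K).FiniteIndex := ⟨hmem.1⟩
    have hcl : IsClosed (((K.comap (MulAut.conj a).toMonoidHom).subgroupOf K : Subgroup K) :
        Set K) := by
      have : Continuous (fun x : K => a * x * a⁻¹) := by fun_prop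
      exact hK.preimage this
    have hop := Subgroup.isOpen_of_isClosed_of_finiteIndex _ hcl
    obtain ⟨O, hO, hOL⟩ := isOpen_induced_iff.1 hop
    have h1O : (1 : G) ∈ O := by
      have : (1 : K) ∈ Subtype.val ⁻¹' O := by rw [hOL]; exact Subgroup.one_mem _
      exact this
    have hcW : (fun x : G => a * x * a⁻¹) ⁻¹' W ∈ 𝓝 (1 : G) := by
      have : Continuous (fun x : G => a * x * a⁻¹) := by fun_prop
      exact this.continuousAt.preimage_mem_nhds (by simpa using hW)
    refine Filter.mem_map.2 (LocalizedAt.mem_nhds_one.2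
      ⟨O ∩ (fun x : G => a * x * a⁻¹) ⁻¹' W, Filter.inter_mem (hO.mem_nhds h1O) hcW,
        fun x hx hxW => h _ ?_ ?_⟩)
    · have : (⟨LocalizedAt.incl K x, hx⟩ : K) ∈ Subtype.val ⁻¹' O := hxW.1
      rw [hOL] at this
      simpa [Subgroup.mem_subgroupOf] using this
    · simpa using hxW.2

/-- The `K`-localized topology is the only group topology on the commensurator of `K` making the
inclusion of `K` continuous and open. -/
theorem LocalizedAt.topology_unique [IsTopologicalGroup G] {K : Subgroup G}
    (τ : TopologicalSpace (LocalizedAt K)) (hτ : @IsTopologicalGroup (LocalizedAt K) τ _)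
    (hc : @Continuous K (LocalizedAt K) _ τ (LocalizedAt.ofSubgroup K))
    (ho : @IsOpenMap K (LocalizedAt K) _ τ (LocalizedAt.ofSubgroup K)) :
    τ = LocalizedAt.topology K := by
  refine TopologicalSpace.ext_iff.2 fun V => ⟨fun hV g hg => ?_, fun hV => ?_⟩
  · have hV' : IsOpen {k : K | g * LocalizedAt.ofSubgroup K k ∈ V} := by
      have : @Continuous K (LocalizedAt K) _ τ (fun k => g * LocalizedAt.ofSubgroup K k) :=
        (continuous_const_mul g).comp hc
      exact hV.preimage this
    obtain ⟨W, hW, hWV⟩ := isOpen_induced_iff.1 hV'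
    refine ⟨W, hW.mem_nhds ?_, fun x hx hxW => ?_⟩
    · have : (1 : K) ∈ Subtype.val ⁻¹' W := by rw [hWV]; simpa using hg
      exact this
    · have : (⟨LocalizedAt.incl K x, hx⟩ : K) ∈ Subtype.val ⁻¹' W := hxW
      rw [hWV] at this
      exact this
  · refine (@isOpen_iff_mem_nhds _ τ V).2 ?_
    intro g hg
    obtain ⟨W, hW, h⟩ := LocalizedAt.isOpen_iff.1 hV g hg
    obtain ⟨W', hW'W, hW', h1⟩ := mem_nhds_iff.1 hW
    have hop := ho _ (hW'.preimage (continuous_subtype_val (p := fun x => x ∈ K)))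
    have hop' := (@isOpenMap_mul_left _ τ _ _ g) _ hop
    refine @Filter.mem_of_superset _ (@nhds _ τ g) _ _ (@IsOpen.mem_nhds _ τ g _ hop' ?_) ?_
    · exact ⟨1, ⟨1, h1, map_one _⟩, mul_one g⟩
    · rintro _ ⟨_, ⟨k, hk, rfl⟩, rfl⟩
      exact h _ k.2 (hW'W hk)

end Localization

end TDLC

open TDLC

/-!
Everything rests on a reformulation of regional expansiveness. Call a compact open subgroup `W` and
a finite set `F` an expansive pair if the conjugates of `W` by the *abstract* subgroup generated by
`F` intersect trivially. A t.d.l.c. group is regionally expansive if and only if it has an expansive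
pair, and then the elements of `F` can be taken from any prescribed dense subset
(`exists_isExpansivePair_dense`). Hence regional expansiveness passes to dense locally compact
subgroups.

Two consequences carry the second half of the theorem. If all elements of `F` have open
centralisers, the group is discrete (`IsExpansivePair.discreteTopology_of_centralizer`). A directed
family of closed subgroups normalised by `F` with discrete intersection has a discrete member
(`IsExpansivePair.exists_discrete_of_directed`).

Let `H` be a non-discrete dense locally compact subgroup of a regionally expansive, topologically
simple group. By the first consequence, with `F` inside the quasi-centre of `H`, that quasi-centre
is trivial, so `H` has no discrete non-trivial normal subgroup. By the second, the
intersection of all non-trivial closed normal subgroups of `H` is then not discrete: the monolith of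
`H` is non-discrete. Applied to the monolith of `H` in place of `H`, the same result shows that this
monolith is topologically simple.

For a robustly monolithic `G` with monolith `M`, a non-discrete dense locally compact subgroup `H`
meets `M` in a non-discrete group `K`: some expansive pair of `H` lies in a subgroup that normalises
the open subgroups `M V`, which shrink to `M`. Open subgroups of `M` have trivial centraliser in
`G`, so `G` itself is regionally expansive. The closure in `G` of `K`, and that of
any non-trivial closed normal subgroup of `H`, contains `M`, which is not abelian; so these subgroups
do not commute and hence meet non-trivially. Therefore the monolith of `H` contains that of `K`, and
it embeds densely into `M` (`IsRobustlyMonolithic.of_isDenseGroupEmbedding`).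

For the arithmetic part, the compact open subgroup of an expansive pair is pro-`π` with `π` finite:
intersecting conjugates one after the other along words in `F`, every step has index bounded by a
constant (`exists_smooth_subgroup`). Sylow theory for profinite groups is obtained from the finite
case by compactness. A prime outside the local prime content has finite Sylow subgroups and can be
avoided by passing to an open subgroup, so `G` is locally pro-`η(G)`. Finally, the commensurator of a
Sylow subgroup of a compact open subgroup is dense by a Frattini type argument
(`IsProPSylow.dense_commensurator`), so that the `p`-localization is a dense locally compact
subgroup and the results above apply to it.
-/

namespace TDLC

/-! ### Compact open subgroups and discreteness -/

section Basics

variable {G : Type*} [Group G] [TopologicalSpace G] [IsTopologicalGroup G]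

/-- Van Dantzig's theorem. -/
theorem exists_compact_open_subgroup_subset [T2Space G] [LocallyCompactSpace G]
    [TotallyDisconnectedSpace G] {O : Set G} (hO : O ∈ 𝓝 (1 : G)) :
    ∃ V : Subgroup G, IsOpen (V : Set G) ∧ IsCompact (V : Set G) ∧ (V : Set G) ⊆ O := by
  obtain ⟨K, hK, hKO, hKc⟩ := local_compact_nhds hO
  obtain ⟨C, hC, h1C, hCK⟩ := loc_compact_Haus_tot_disc_of_zero_dim.mem_nhds_iff.1 hK
  have hCc : IsCompact C := hKc.of_isClosed_subset hC.1 hCK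
  obtain ⟨T, hT, hCT⟩ := compact_open_separated_mul_right hCc hC.2 subset_rfl
  -- The stabiliser of the compact open set `C` under right translation.
  let V : Subgroup G :=
    { carrier := {g | ∀ x, x ∈ C ↔ x * g ∈ C}
      one_mem' := by simp
      mul_mem' := fun {a b} ha hb x => by rw [ha, hb, mul_assoc]
      inv_mem' := fun {a} ha x => by rw [ha (x * a⁻¹), inv_mul_cancel_right] }
  have hVC : (V : Set G) ⊆ C := fun g hg => by simpa using (hg 1).1 h1C
  have hV : IsOpen (V : Set G) := by
    refine V.isOpen_of_mem_nhds (g := 1) ?_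
    filter_upwards [hT, inv_mem_nhds_one G hT] with g hg hg' x
    refine ⟨fun hx => hCT (Set.mul_mem_mul hx hg), fun hx => ?_⟩
    simpa using hCT (Set.mul_mem_mul hx hg')
  exact ⟨V, hV, hCc.of_isClosed_subset (V.isClosed_of_isOpen hV) hVC, hVC.trans (hCK.trans hKO)⟩

theorem exists_compact_open_subgroup_normalized [T2Space G] [LocallyCompactSpace G]
    [TotallyDisconnectedSpace G] {W : Subgroup G} (hW : IsCompact (W : Set G)) {O : Set G}
    (hO : O ∈ 𝓝 (1 : G)) :
    ∃ V : Subgroup G, IsOpen (V : Set G) ∧ IsCompact (V : Set G) ∧ (V : Set G) ⊆ O ∧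
      ∀ w ∈ W, ∀ x ∈ V, w * x * w⁻¹ ∈ V := by
  obtain ⟨V₀, hV₀, hV₀c, hV₀O⟩ := exists_compact_open_subgroup_subset hO
  let V : Subgroup G :=
    { carrier := {x | ∀ w ∈ W, w * x * w⁻¹ ∈ V₀}
      one_mem' := by simp [V₀.one_mem]
      mul_mem' := fun {a b} ha hb w hw => by simpa [mul_assoc] using V₀.mul_mem (ha w hw) (hb w hw)
      inv_mem' := fun {a} ha w hw => by simpa [mul_assoc] using V₀.inv_mem (ha w hw) }
  have hVV₀ : V ≤ V₀ := fun x hx => by simpa using hx 1 W.one_mem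
  have hV : IsOpen (V : Set G) := by
    refine V.isOpen_of_mem_nhds (g := 1) ?_
    refine hW.eventually_forall_of_forall_eventually (P := fun x w => w * x * w⁻¹ ∈ V₀)
      fun w _ => ?_
    exact (hV₀.preimage (by fun_prop : Continuous fun z : G × G => z.2 * z.1 * z.2⁻¹)).mem_nhds
      (by simp [V₀.one_mem])
  refine ⟨V, hV, hV₀c.of_isClosed_subset (V.isClosed_of_isOpen hV) hVV₀,
    fun x hx => hV₀O (hVV₀ hx), fun w hw x hx v hv => ?_⟩
  simpa [mul_assoc] using hx (v * w) (W.mul_mem hv hw)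

theorem discreteTopology_subgroup_iff {N : Subgroup G} :
    DiscreteTopology N ↔ ∃ O ∈ 𝓝 (1 : G), ∀ x ∈ N, x ∈ O → x = 1 := by
  rw [discreteTopology_iff_isOpen_singleton_one, isOpen_singleton_iff_nhds_eq_pure,
    nhds_subtype_eq_comap]
  constructor
  · intro h
    have h1 : ({1} : Set N) ∈ Filter.comap ((↑) : N → G) (𝓝 ((1 : N) : G)) := by
      rw [h]; exact Filter.mem_pure.2 rfl
    obtain ⟨O, hO, hOs⟩ := Filter.mem_comap.1 h1
    refine ⟨O, by simpa using hO, fun x hx hxO => ?_⟩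
    have := @hOs ⟨x, hx⟩ hxO
    simpa using this
  · rintro ⟨O, hO, h⟩
    refine le_antisymm (Filter.le_pure_iff.2 ?_) ?_
    · refine Filter.mem_comap.2 ⟨O, by simpa using hO, fun x hx => ?_⟩
      have := h x x.2 hx
      simpa using this
    · rw [← nhds_subtype_eq_comap]; exact pure_le_nhds _

theorem discreteTopology_of_nhds {O : Set G} (hO : O ∈ 𝓝 (1 : G)) (h : ∀ x ∈ O, x = 1) :
    DiscreteTopology G := by
  rw [discreteTopology_iff_isOpen_singleton_one]
  refine isOpen_singleton_iff_nhds_eq_pure _ |>.2 (le_antisymm (Filter.le_pure_iff.2 ?_)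
    (pure_le_nhds _))
  exact Filter.mem_of_superset hO fun x hx => h x hx

theorem discreteTopology_of_finite_open [T2Space G] {U : Subgroup G} (hU : IsOpen (U : Set G))
    (hfin : Finite U) : DiscreteTopology G := by
  have hd : DiscreteTopology U := inferInstance
  obtain ⟨O, hO, h⟩ := discreteTopology_subgroup_iff.1 hd
  exact discreteTopology_of_nhds (Filter.inter_mem (hU.mem_nhds U.one_mem) hO)
    fun x hx => h x hx.1 hx.2

end Basics

theorem exists_inter_subset_of_directed {X : Type*} [TopologicalSpace X] {K O : Set X}
    (hK : IsCompact K) (hO : IsOpen O) {ι : Type*} [Nonempty ι] (Z : ι → Set X)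
    (hZ : ∀ i, IsClosed (Z i)) (hd : Directed (· ⊇ ·) Z) (h : K ∩ ⋂ i, Z i ⊆ O) :
    ∃ i, K ∩ Z i ⊆ O := by
  obtain ⟨i, hi⟩ := (hK.diff hO).elim_directed_family_closed Z hZ (by
    ext x
    simp only [Set.mem_inter_iff, Set.mem_sdiff, Set.mem_empty_iff_false, iff_false]
    rintro ⟨⟨hxK, hxO⟩, hx⟩
    exact hxO (h ⟨hxK, hx⟩)) hd
  refine ⟨i, fun x hx => ?_⟩
  by_contra hxO
  exact (Set.ext_iff.1 hi x).1 ⟨⟨hx.1, hxO⟩, hx.2⟩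

/-! ### Expansive pairs -/

section Expansive

variable {G : Type*} [Group G]

/-- The intersection of the conjugates of `W` by the elements of the abstract subgroup generated
by `F` is trivial. A t.d.l.c. group is regionally expansive if and only if this happens for some
compact open subgroup `W` and some finite set `F`. -/
def IsExpansivePair (W : Subgroup G) (F : Set G) : Prop :=
  ∀ x : G, (∀ d ∈ Subgroup.closure F, d⁻¹ * x * d ∈ W) → x = 1

theorem IsExpansivePair.mono {W W' : Subgroup G} {F F' : Set G} (h : IsExpansivePair W F)
    (hW : W' ≤ W) (hF : F ⊆ F') : IsExpansivePair W' F' :=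
  fun x hx => h x fun d hd => hW (hx d (Subgroup.closure_mono hF hd))

theorem IsExpansivePair.comap {H : Type*} [Group H] {ψ : H →* G} (hψ : Function.Injective ψ)
    {W : Subgroup G} {F : Set H} (h : IsExpansivePair W (ψ '' F)) :
    IsExpansivePair (W.comap ψ) F := by
  intro x hx
  apply hψ
  rw [map_one]
  refine h _ fun d hd => ?_
  rw [← MonoidHom.map_closure] at hd
  obtain ⟨d, hd, rfl⟩ := hd
  simpa using hx d hd

/-- A subgroup of `W` that is normalised by `F` is trivial. -/
theorem IsExpansivePair.eq_one_of_mem {W : Subgroup G} {F : Set G} (h : IsExpansivePair W F)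
    {N : Set G} (hNW : N ⊆ W) (hN : ∀ f ∈ F, ∀ x ∈ N, f⁻¹ * x * f ∈ N ∧ f * x * f⁻¹ ∈ N)
    {x : G} (hx : x ∈ N) : x = 1 := by
  have hle : Subgroup.closure F ≤ Subgroup.normalizer N := by
    refine (Subgroup.closure_le _).2 fun f hf n => ?_
    refine ⟨fun hn => (hN f hf n hn).2, fun hn => ?_⟩
    simpa [mul_assoc] using (hN f hf _ hn).1
  refine h x fun d hd => hNW ?_
  simpa using (inv_mem (hle hd) x).1 hx

variable [TopologicalSpace G] [IsTopologicalGroup G]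

/-- Inside the group generated by a compact open subgroup `W` and a finite set `F`, some finite
subset of a prescribed dense set generates a group that meets every coset of `W`. -/
theorem exists_finite_subset_dense {W : Subgroup G} (hWo : IsOpen (W : Set G))
    (hWc : IsCompact (W : Set G)) {F : Set G} (hF : F.Finite) {D : Set G} (hD : Dense D) :
    ∃ F' ⊆ D, F'.Finite ∧ F' ⊆ Subgroup.closure (W ∪ F) ∧
      ∀ g ∈ Subgroup.closure (W ∪ F), ∃ d ∈ Subgroup.closure F', d⁻¹ * g ∈ W := by
  -- `X` is symmetric, bi-invariant under `W` and generates the same group.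
  set X : Set G := W * (F ∪ F⁻¹ ∪ {1}) * W with hX
  have hXc : IsCompact X :=
    (hWc.mul (((hF.union hF.inv).union (Set.finite_singleton 1)).isCompact)).mul hWc
  have hXO : X ⊆ Subgroup.closure (W ∪ F) := by
    have hW : ∀ w ∈ W, w ∈ Subgroup.closure (W ∪ F) :=
      fun w hw => Subgroup.subset_closure (Or.inl hw)
    rintro _ ⟨_, ⟨w, hw, f, hf, rfl⟩, w', hw', rfl⟩
    refine mul_mem (mul_mem (hW w hw) ?_) (hW w' hw')
    rcases hf with (hf | hf) | hf
    · exact Subgroup.subset_closure (Or.inr hf)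
    · exact inv_mem_iff.1 (Subgroup.subset_closure (Or.inr hf))
    · rw [Set.mem_singleton_iff.1 hf]; exact one_mem _
  have hXr : ∀ x ∈ X, ∀ w ∈ W, x * w ∈ X := by
    rintro _ ⟨a, ha, w', hw', rfl⟩ w hw
    exact ⟨a, ha, w' * w, W.mul_mem hw' hw, by simp [mul_assoc]⟩
  have hXl : ∀ x ∈ X, ∀ w ∈ W, w * x ∈ X := by
    rintro _ ⟨_, ⟨w, hw, f, hf, rfl⟩, w', hw', rfl⟩ v hv
    exact ⟨_, ⟨v * w, W.mul_mem hv hw, f, hf, rfl⟩, w', hw', by simp [mul_assoc]⟩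
  have hWF : ∀ x ∈ (W ∪ F : Set G), x ∈ X ∧ x⁻¹ ∈ X := by
    rintro x (hx | hx)
    · exact ⟨⟨x * 1, ⟨x, hx, 1, by simp, rfl⟩, 1, W.one_mem, by simp⟩,
        ⟨x⁻¹ * 1, ⟨x⁻¹, W.inv_mem hx, 1, by simp, rfl⟩, 1, W.one_mem, by simp⟩⟩
    · exact ⟨⟨1 * x, ⟨1, W.one_mem, x, by simp [hx], rfl⟩, 1, W.one_mem, by simp⟩,
        ⟨1 * x⁻¹, ⟨1, W.one_mem, x⁻¹, by simp [hx], rfl⟩, 1, W.one_mem, by simp⟩⟩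
  have hopen : ∀ x : G, IsOpen ((fun y => x⁻¹ * y) ⁻¹' (W : Set G)) :=
    fun x => hWo.preimage (continuous_const_mul _)
  have hex : ∀ x : G, ∃ d ∈ D, x⁻¹ * d ∈ W := by
    intro x
    obtain ⟨d, hd, hdD⟩ := hD.inter_open_nonempty _ (hopen x) ⟨x, by simp⟩
    exact ⟨d, hdD, hd⟩
  choose d hdD hdW using hex
  obtain ⟨t, htX, htfin, ht⟩ := hXc.elim_finite_subcover_image (b := X)
    (c := fun x => (fun y => x⁻¹ * y) ⁻¹' (W : Set G)) (fun x _ => hopen x)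
    (fun x hx => Set.mem_biUnion hx (by simp))
  have hdX : ∀ x ∈ X, d x ∈ X := fun x hx => by simpa using hXr x hx _ (hdW x)
  have key : ∀ y ∈ X, ∃ f ∈ d '' t, f⁻¹ * y ∈ W := by
    intro y hy
    obtain ⟨x, hx, hxy⟩ := Set.mem_iUnion₂.1 (ht hy)
    refine ⟨d x, ⟨x, hx, rfl⟩, ?_⟩
    simpa [mul_assoc] using W.mul_mem (W.inv_mem (hdW x)) hxy
  refine ⟨d '' t, ?_, htfin.image d, ?_, ?_⟩
  · rintro _ ⟨x, _, rfl⟩; exact hdD x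
  · rintro _ ⟨x, hx, rfl⟩; exact hXO (hdX x (htX hx))
  have step : ∀ x y, y ∈ X → (∃ e ∈ Subgroup.closure (d '' t), e⁻¹ * x ∈ W) →
      ∃ e ∈ Subgroup.closure (d '' t), e⁻¹ * (x * y) ∈ W := by
    rintro x y hy ⟨e, he, hx⟩
    obtain ⟨f, hf, hfy⟩ := key _ (hXl y hy _ hx)
    exact ⟨e * f, mul_mem he (Subgroup.subset_closure hf), by simpa [mul_assoc] using hfy⟩
  intro g hg
  induction hg using Subgroup.closure_induction_right with
  | one => exact ⟨1, one_mem _, by simp⟩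
  | mul_right x hx y hy ih => exact step x y (hWF y hy).1 ih
  | mul_inv_cancel x hx y hy ih => exact step x y⁻¹ (hWF y hy).2 ih

/-- If `W` has trivial core in the group it generates together with `F`, then `F` can be replaced
by a finite subset of a prescribed dense set so as to obtain an expansive pair. -/
theorem exists_isExpansivePair_dense {W : Subgroup G} (hWo : IsOpen (W : Set G))
    (hWc : IsCompact (W : Set G)) {F : Set G} (hF : F.Finite)
    (h : ∀ x : G, (∀ g ∈ Subgroup.closure (W ∪ F), g⁻¹ * x * g ∈ W) → x = 1)
    {D : Set G} (hD : Dense D) :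
    ∃ F' ⊆ D, F'.Finite ∧ F' ⊆ Subgroup.closure (W ∪ F) ∧ IsExpansivePair W F' := by
  obtain ⟨F', h1, h2, h3, h4⟩ := exists_finite_subset_dense hWo hWc hF hD
  refine ⟨F', h1, h2, h3, fun x hx => h x fun g hg => ?_⟩
  obtain ⟨d, hd, hdg⟩ := h4 g hg
  have := W.mul_mem (W.mul_mem (W.inv_mem hdg) (hx d hd)) hdg
  simpa [mul_assoc] using this

theorem exists_isExpansivePair_dense_of_isExpansivePair {W : Subgroup G}
    (hWo : IsOpen (W : Set G)) (hWc : IsCompact (W : Set G)) {F : Set G} (hF : F.Finite)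
    (h : IsExpansivePair W F) {D : Set G} (hD : Dense D) :
    ∃ F' ⊆ D, F'.Finite ∧ IsExpansivePair W F' := by
  obtain ⟨F', h1, h2, _, h4⟩ := exists_isExpansivePair_dense hWo hWc hF
    (fun x hx => h x fun d hd => hx d (Subgroup.closure_mono Set.subset_union_right hd)) hD
  exact ⟨F', h1, h2, h4⟩

theorem IsRegionallyExpansive.exists_isExpansivePair (h : IsRegionallyExpansive G) :
    ∃ (W : Subgroup G) (F : Set G), IsOpen (W : Set G) ∧ IsCompact (W : Set G) ∧ F.Finite ∧
      IsExpansivePair W F := by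
  obtain ⟨O, hO, ⟨C, hC, hCO⟩, W, hWo, hWc, hW⟩ := h
  obtain ⟨t, ht⟩ := hC.elim_finite_subcover (fun x : O => (fun y => x⁻¹ * y) ⁻¹' (W : Set O))
    (fun x => hWo.preimage (continuous_const_mul _)) (fun x _ => Set.mem_iUnion.2 ⟨x, by simp⟩)
  have hgen : Subgroup.closure ((W : Set O) ∪ t) = ⊤ := by
    rw [eq_top_iff, ← hCO, Subgroup.closure_le]
    intro c hc
    obtain ⟨x, hx, hxc⟩ := Set.mem_iUnion₂.1 (ht hc)
    have := mul_mem (Subgroup.subset_closure (Or.inr hx) : x ∈ Subgroup.closure ((W : Set O) ∪ t))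
      (Subgroup.subset_closure (Or.inl hxc))
    simpa using this
  obtain ⟨F, -, hF, -, hWF⟩ := exists_isExpansivePair_dense hWo hWc t.finite_toSet (fun x hx => by
    have : x ∈ W.normalCore := fun g => by
      simpa using hx g⁻¹ (hgen ▸ Subgroup.mem_top _)
    rwa [hW, Subgroup.mem_bot] at this) dense_univ
  refine ⟨W.map O.subtype, O.subtype '' F, ?_, ?_, hF.image _, fun x hx => ?_⟩
  · exact hO.isOpenMap_subtype_val _ hWo
  · exact hWc.image continuous_subtype_val
  · obtain ⟨y, hy, hyx⟩ := hx 1 (one_mem _)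
    have hyx : (y : G) = x := by simpa using hyx
    subst hyx
    rw [hWF y fun d hd => ?_, Subgroup.coe_one]
    have := hx d (by rw [← MonoidHom.map_closure]; exact ⟨d, hd, rfl⟩)
    obtain ⟨z, hz, hzx⟩ := this
    have : z = d⁻¹ * y * d := Subtype.ext (by simpa using hzx)
    rwa [← this]

theorem IsExpansivePair.isRegionallyExpansive {W : Subgroup G} {F : Set G}
    (hWo : IsOpen (W : Set G)) (hWc : IsCompact (W : Set G)) (hF : F.Finite)
    (h : IsExpansivePair W F) : IsRegionallyExpansive G := by
  set O := Subgroup.closure ((W : Set G) ∪ F) with hO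
  have hWO : W ≤ O := fun w hw => Subgroup.subset_closure (Or.inl hw)
  have hOo : IsOpen (O : Set G) := Subgroup.isOpen_mono hWO hWo
  refine ⟨O, hOo, ⟨Subtype.val ⁻¹' ((W : Set G) ∪ F), ?_, ?_⟩, W.subgroupOf O,
    hWo.preimage continuous_subtype_val, ?_, ?_⟩
  · rw [Topology.IsEmbedding.subtypeVal.isCompact_iff, Set.image_preimage_eq_of_subset]
    · exact hWc.union hF.isCompact
    · rw [Subtype.range_coe]; exact Subgroup.subset_closure
  · exact Subgroup.closure_closure_coe_preimage
  · rw [Topology.IsEmbedding.subtypeVal.isCompact_iff]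
    change IsCompact (Subtype.val '' (Subtype.val ⁻¹' (W : Set G)))
    rw [Set.image_preimage_eq_of_subset]
    · exact hWc
    · rw [Subtype.range_coe]; exact hWO
  · refine (Subgroup.eq_bot_iff_forall _).2 fun x hx => Subtype.ext ?_
    refine h x fun d hd => ?_
    have hdO : d ∈ O := Subgroup.closure_mono Set.subset_union_right hd
    have := hx ⟨d, hdO⟩⁻¹
    simpa [Subgroup.mem_subgroupOf] using this

/-- In a directed family of closed subgroups normalised by `F`, some member is discrete as soon as
the intersection is. Choose `W'` compact open meeting the intersection trivially; by
compactness some member meets `W'` within the intersection of the conjugates of `W'` by `F`, and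
then that part of it is normalised by `F`. -/
theorem IsExpansivePair.exists_discrete_of_directed [T2Space G] [LocallyCompactSpace G]
    [TotallyDisconnectedSpace G] {W : Subgroup G} {F : Set G} (h : IsExpansivePair W F)
    (hF : F.Finite) (hWo : IsOpen (W : Set G)) {ι : Type*} [Nonempty ι] (N : ι → Subgroup G)
    (hN : ∀ i, IsClosed (N i : Set G)) (hdir : Directed (· ≥ ·) N)
    (hNF : ∀ i, ∀ f ∈ F, ∀ x ∈ N i, f⁻¹ * x * f ∈ N i ∧ f * x * f⁻¹ ∈ N i)
    (hd : DiscreteTopology (⨅ i, N i : Subgroup G)) : ∃ i, DiscreteTopology (N i) := by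
  obtain ⟨O, hO, hO1⟩ := discreteTopology_subgroup_iff.1 hd
  obtain ⟨V, hVo, hVc, hVO⟩ := exists_compact_open_subgroup_subset
    (Filter.inter_mem hO (hWo.mem_nhds W.one_mem))
  have hVW : V ≤ W := fun x hx => (hVO hx).2
  let Z : Set G := ⋂ f ∈ F, {x | f⁻¹ * x * f ∈ V ∧ f * x * f⁻¹ ∈ V}
  have hZ : IsOpen Z := by
    refine hF.isOpen_biInter fun f _ => ?_
    exact (hVo.preimage (by fun_prop : Continuous fun x => f⁻¹ * x * f)).inter
      (hVo.preimage (by fun_prop : Continuous fun x => f * x * f⁻¹))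
  obtain ⟨i, hi⟩ := exists_inter_subset_of_directed hVc hZ (fun i => (N i : Set G)) hN
    (fun i j => by
      obtain ⟨k, hk, hk'⟩ := hdir i j
      exact ⟨k, hk, hk'⟩) (by
    rintro x ⟨hxV, hx⟩
    have := hO1 x (by simpa [Subgroup.mem_iInf] using hx) (hVO hxV).1
    subst this
    simp [Z, V.one_mem])
  refine ⟨i, discreteTopology_subgroup_iff.2 ⟨V, hVo.mem_nhds V.one_mem, fun x hx hxV => ?_⟩⟩
  refine h.eq_one_of_mem (N := (V : Set G) ∩ N i) (fun x hx => hVW hx.1) ?_ ⟨hxV, hx⟩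
  intro f hf x hx
  have hxZ := Set.mem_iInter₂.1 (hi hx) f hf
  exact ⟨⟨hxZ.1, (hNF i f hf x hx.2).1⟩, ⟨hxZ.2, (hNF i f hf x hx.2).2⟩⟩

/-- If the elements of `F` have open centralisers, the group is discrete. -/
theorem IsExpansivePair.discreteTopology_of_centralizer {W : Subgroup G} {F : Set G}
    (h : IsExpansivePair W F) (hF : F.Finite) (hWo : IsOpen (W : Set G))
    (hc : ∀ f ∈ F, ∀ᶠ v in 𝓝 (1 : G), v * f = f * v) : DiscreteTopology G := by
  have hev : ∀ᶠ v in 𝓝 (1 : G), v ∈ W ∧ ∀ f ∈ F, v * f = f * v :=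
    (hWo.eventually_mem W.one_mem).and ((Filter.eventually_all_finite hF).2 hc)
  refine discreteTopology_of_nhds hev fun x hx => ?_
  refine h.eq_one_of_mem (N := {x}) (by simpa using hx.1) ?_ rfl
  rintro f hf _ rfl
  constructor
  · simp [mul_assoc, hx.2 f hf]
  · simp [← hx.2 f hf]

end Expansive

/-! ### Monoliths and dense embeddings -/

section Monolith

variable {G : Type*} [Group G] [TopologicalSpace G]

theorem monolith_le {N : Subgroup G} (h : N ≠ ⊥) (hn : N.Normal) (hc : IsClosed (N : Set G)) :
    monolith G ≤ N :=
  sInf_le ⟨h, hn, hc⟩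

theorem mem_monolith_iff {x : G} :
    x ∈ monolith G ↔ ∀ N : Subgroup G, N ≠ ⊥ → N.Normal → IsClosed (N : Set G) → x ∈ N := by
  simp only [monolith, Subgroup.mem_sInf, Set.mem_ofPred_eq, and_imp]

instance monolith_normal : (monolith G).Normal where
  conj_mem x hx g := mem_monolith_iff.2 fun N h hn hc =>
    hn.conj_mem x (mem_monolith_iff.1 hx N h hn hc) g

theorem isClosed_monolith : IsClosed (monolith G : Set G) := by
  rw [monolith, Subgroup.coe_sInf]
  exact isClosed_biInter fun N hN => hN.2.2

theorem map_mem_monolith (e : G ≃ₜ* G) {x : G} (hx : x ∈ monolith G) : e x ∈ monolith G := by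
  refine mem_monolith_iff.2 fun N h hn hc => ?_
  have := mem_monolith_iff.1 hx (N.comap (e : G →* G)) ?_ inferInstance
    (hc.preimage e.continuous_toFun)
  · exact this
  · intro hb
    refine h ((Subgroup.eq_bot_iff_forall _).2 fun y hy => ?_)
    have : e.symm y ∈ N.comap (e : G →* G) := by simpa using hy
    rw [hb, Subgroup.mem_bot] at this
    simpa using congrArg e this

theorem IsTopologicallySimple.monolith_eq_top (h : IsTopologicallySimple G) :
    monolith G = ⊤ := by
  refine eq_top_iff.2 fun x _ => mem_monolith_iff.2 fun N hN hn hc => ?_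
  rw [(h.2 N hn hc).resolve_left hN]
  exact Subgroup.mem_top x

/-- The subgroup of elements with open centraliser. -/
def quasiCenter (G : Type*) [Group G] [TopologicalSpace G] : Subgroup G where
  carrier := {x | ∀ᶠ v in 𝓝 (1 : G), v * x = x * v}
  one_mem' := by simp
  mul_mem' {a b} ha hb := by
    filter_upwards [ha, hb] with v h1 h2
    rw [← mul_assoc, h1, mul_assoc, h2, mul_assoc]
  inv_mem' {a} ha := by
    filter_upwards [ha] with v h1
    rw [mul_inv_eq_iff_eq_mul, mul_assoc, h1, inv_mul_cancel_left]

variable [IsTopologicalGroup G]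

instance quasiCenter_normal : (quasiCenter G).Normal where
  conj_mem x hx g := by
    have ht : Filter.Tendsto (fun v => g⁻¹ * v * g) (𝓝 1) (𝓝 1) := by
      have : Continuous fun v => g⁻¹ * v * g := by fun_prop
      simpa using this.tendsto 1
    change ∀ᶠ v in 𝓝 (1 : G), v * (g * x * g⁻¹) = g * x * g⁻¹ * v
    filter_upwards [ht.eventually hx] with v hv
    have : g * (g⁻¹ * v * g * x) * g⁻¹ = g * (x * (g⁻¹ * v * g)) * g⁻¹ := by rw [hv]
    simpa [mul_assoc] using this

theorem le_quasiCenter_of_discrete {N : Subgroup G} (hn : N.Normal) (hd : DiscreteTopology N) :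
    N ≤ quasiCenter G := by
  intro x hx
  obtain ⟨O, hO, h⟩ := discreteTopology_subgroup_iff.1 hd
  have ht : Filter.Tendsto (fun v => v * x * v⁻¹ * x⁻¹) (𝓝 1) (𝓝 1) := by
    have : Continuous fun v => v * x * v⁻¹ * x⁻¹ := by fun_prop
    simpa using this.tendsto 1
  change ∀ᶠ v in 𝓝 (1 : G), v * x = x * v
  filter_upwards [ht hO] with v hv
  have := h _ (N.mul_mem (hn.conj_mem x hx v) (N.inv_mem hx)) hv
  rwa [mul_inv_eq_one, mul_inv_eq_iff_eq_mul] at this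

theorem commute_of_mem_closure [T2Space G] {A B : Set G} (h : ∀ a ∈ A, ∀ b ∈ B, a * b = b * a)
    {a b : G} (ha : a ∈ closure A) (hb : b ∈ closure B) : a * b = b * a := by
  have h1 : closure A ⊆ B.centralizer :=
    closure_minimal (fun a ha b hb => (h a ha b hb).symm) (Set.isClosed_centralizer B)
  have h2 : closure B ⊆ (closure A).centralizer :=
    closure_minimal (fun b hb a ha => (h1 ha b hb).symm) (Set.isClosed_centralizer _)
  exact h2 hb a ha

/-- Normal subgroups with trivial intersection commute. -/
theorem commute_of_normal_of_inf_eq_bot {G : Type*} [Group G] {A B : Subgroup G} (hA : A.Normal)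
    (hB : B.Normal) (h : A ⊓ B = ⊥) {a b : G} (ha : a ∈ A) (hb : b ∈ B) : a * b = b * a :=
  Subgroup.commute_of_normal_of_disjoint A B hA hB (disjoint_iff.2 h) a b ha hb

end Monolith

section DenseEmbedding

variable {G : Type u} [Group G] [TopologicalSpace G] {H : Type v} [Group H] [TopologicalSpace H]
  {ψ : H →* G}

theorem IsDenseGroupEmbedding.isTDLC (hψ : IsDenseGroupEmbedding ψ) (hG : IsTDLC G) :
    IsTDLC H where
  isTopologicalGroup := hψ.isTopologicalGroup
  t2Space := hψ.t2Space
  locallyCompactSpace := hψ.locallyCompactSpace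
  totallyDisconnectedSpace := by
    have := hG.totallyDisconnectedSpace
    exact ⟨isTotallyDisconnected_of_image hψ.continuous.continuousOn hψ.injective
      (isTotallyDisconnected_of_totallyDisconnectedSpace _)⟩

theorem IsDenseGroupEmbedding.id (hG : IsTDLC G) : IsDenseGroupEmbedding (MonoidHom.id G) where
  isTopologicalGroup := hG.isTopologicalGroup
  t2Space := hG.t2Space
  locallyCompactSpace := hG.locallyCompactSpace
  continuous := continuous_id
  injective := Function.injective_id
  denseRange := Function.surjective_id.denseRange

theorem IsTDLC.subgroup (hG : IsTDLC G) {N : Subgroup G} (hN : IsClosed (N : Set G)) :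
    IsTDLC N := by
  obtain ⟨_, _, _, _⟩ := hG
  exact ⟨inferInstance, inferInstance, hN.isClosedEmbedding_subtypeVal.locallyCompactSpace,
    inferInstance⟩

/-- An expansive pair of `G` whose finite set lies in the image of `ψ` gives one of `H`. -/
theorem IsDenseGroupEmbedding.exists_isExpansivePair_of_subset_range
    (hψ : IsDenseGroupEmbedding ψ) (hG : IsTDLC G)
    {W : Subgroup G} {F : Set G} (hWo : IsOpen (W : Set G)) (hF : F.Finite)
    (h : IsExpansivePair W F) {D : Set H} (hFD : F ⊆ ψ '' D) :
    ∃ (U : Subgroup H) (F' : Set H), IsOpen (U : Set H) ∧ IsCompact (U : Set H) ∧ F'.Finite ∧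
      F' ⊆ D ∧ ψ '' F' = F ∧ IsExpansivePair U F' := by
  obtain ⟨_, _, _, _⟩ := hψ.isTDLC hG
  obtain ⟨F', hF'D, rfl⟩ := Set.subset_image_iff.1 hFD
  obtain ⟨U, hU, hUc, hUW⟩ := exists_compact_open_subgroup_subset
    ((hWo.preimage hψ.continuous).mem_nhds (show ψ 1 ∈ W by simp))
  exact ⟨U, F', hU, hUc, hF.of_finite_image hψ.injective.injOn, hF'D, rfl,
    (h.comap hψ.injective).mono hUW subset_rfl⟩

theorem IsDenseGroupEmbedding.exists_isExpansivePair
    (hψ : IsDenseGroupEmbedding ψ) (hG : IsTDLC G) (h : IsRegionallyExpansive G)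
    {D : Set H} (hD : Dense (ψ '' D)) :
    ∃ (U : Subgroup H) (F : Set H), IsOpen (U : Set H) ∧ IsCompact (U : Set H) ∧ F.Finite ∧
      F ⊆ D ∧ IsExpansivePair U F := by
  have := hG.isTopologicalGroup
  obtain ⟨W, F, hWo, hWc, hF, hWF⟩ := h.exists_isExpansivePair
  obtain ⟨F', hF'D, hF', hWF'⟩ := exists_isExpansivePair_dense_of_isExpansivePair hWo hWc hF hWF hD
  obtain ⟨U, F, h1, h2, h3, h4, -, h5⟩ :=
    hψ.exists_isExpansivePair_of_subset_range hG hWo hF' hWF' hF'D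
  exact ⟨U, F, h1, h2, h3, h4, h5⟩

theorem IsDenseGroupEmbedding.isRegionallyExpansive
    (hψ : IsDenseGroupEmbedding ψ) (hG : IsTDLC G) (h : IsRegionallyExpansive G) :
    IsRegionallyExpansive H := by
  have := hψ.isTopologicalGroup
  obtain ⟨U, F, hU, hUc, hF, -, hUF⟩ := hψ.exists_isExpansivePair hG h (D := Set.univ)
    (by rw [Set.image_univ]; exact hψ.denseRange)
  exact hUF.isRegionallyExpansive hU hUc hF

theorem IsDenseGroupEmbedding.normal_topologicalClosure_map [IsTopologicalGroup G]
    (hψ : IsDenseGroupEmbedding ψ) {N : Subgroup H} (hN : N.Normal) :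
    (N.map ψ).topologicalClosure.Normal where
  conj_mem x hx g := by
    have hcl : IsClosed {g : G | g * x * g⁻¹ ∈ (N.map ψ).topologicalClosure} :=
      (N.map ψ).isClosed_topologicalClosure.preimage
        (by fun_prop : Continuous fun g => g * x * g⁻¹)
    have huniv : closure (Set.range ψ) ⊆ {g : G | g * x * g⁻¹ ∈ (N.map ψ).topologicalClosure} := by
      refine closure_minimal ?_ hcl
      rintro _ ⟨h, rfl⟩
      have hc : Continuous fun y => ψ h * y * (ψ h)⁻¹ := by fun_prop
      refine map_mem_closure (f := fun y => ψ h * y * (ψ h)⁻¹) hc hx ?_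
      rintro _ ⟨n, hn, rfl⟩
      exact ⟨h * n * h⁻¹, hN.conj_mem n hn h, by simp⟩
    exact huniv (hψ.denseRange g)

theorem IsDenseGroupEmbedding.monolith_le_closure [IsTopologicalGroup G]
    (hψ : IsDenseGroupEmbedding ψ) {N : Subgroup H} (hN : N.Normal) (hne : N ≠ ⊥) :
    (monolith G : Set G) ⊆ closure (ψ '' N) := by
  have := monolith_le (N := (N.map ψ).topologicalClosure) (fun h => hne ?_)
    (hψ.normal_topologicalClosure_map hN) (N.map ψ).isClosed_topologicalClosure
  · exact this
  · have h1 : N.map ψ = ⊥ := le_bot_iff.1 (h ▸ (N.map ψ).le_topologicalClosure)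
    exact (Subgroup.map_eq_bot_iff_of_injective N hψ.injective).1 h1

/-- If the quasi-centre of `H` were non-trivial, it would be dense in `G`, and an expansive pair of
`H` could be chosen with its finite set in the quasi-centre, forcing `H` to be discrete. -/
theorem IsDenseGroupEmbedding.quasiCenter_eq_bot (hψ : IsDenseGroupEmbedding ψ) (hG : IsTDLC G)
    (he : IsRegionallyExpansive G) (hs : IsTopologicallySimple G) (hd : ¬ DiscreteTopology H) :
    quasiCenter H = ⊥ := by
  have := hG.isTopologicalGroup
  have := hψ.isTopologicalGroup
  by_contra hne
  obtain ⟨U, F, hU, hUc, hF, hFD, hUF⟩ := hψ.exists_isExpansivePair hG he (D := quasiCenter H)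
    (fun x => hψ.monolith_le_closure inferInstance hne (by
      rw [hs.monolith_eq_top]; exact Subgroup.mem_top x))
  exact hd (hUF.discreteTopology_of_centralizer hF hU fun f hf => hFD hf)

/-- A non-discrete dense locally compact subgroup of a regionally expansive, topologically simple
group has a non-discrete monolith: otherwise some non-trivial closed normal subgroup would be
discrete, hence contained in the quasi-centre. -/
theorem IsDenseGroupEmbedding.not_discreteTopology_monolith (hψ : IsDenseGroupEmbedding ψ)
    (hG : IsTDLC G) (he : IsRegionallyExpansive G) (hs : IsTopologicallySimple G)
    (hd : ¬ DiscreteTopology H) : ¬ DiscreteTopology (monolith H) := by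
  have hqc := hψ.quasiCenter_eq_bot hG he hs hd
  obtain ⟨_, _, _, _⟩ := hψ.isTDLC hG
  obtain ⟨_, _, _, _⟩ := hG
  have hden : ∀ N : Subgroup H, N.Normal → N ≠ ⊥ → ∀ x : G, x ∈ closure (ψ '' N) := by
    intro N hN hne x
    exact hψ.monolith_le_closure hN hne (by rw [hs.monolith_eq_top]; exact Subgroup.mem_top x)
  obtain ⟨U, F, hU, hUc, hF, -, hUF⟩ := hψ.exists_isExpansivePair ⟨‹_›, ‹_›, ‹_›, ‹_›⟩ he
    (D := Set.univ) (by rw [Set.image_univ]; exact hψ.denseRange)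
  let S := {N : Subgroup H | N ≠ ⊥ ∧ N.Normal ∧ IsClosed (N : Set H)}
  have htop : (⊤ : Subgroup H) ∈ S := by
    refine ⟨fun h => hd ?_, inferInstance, isClosed_univ⟩
    exact discreteTopology_of_nhds Filter.univ_mem fun x _ => by
      have : x ∈ (⊤ : Subgroup H) := Subgroup.mem_top x
      rwa [h, Subgroup.mem_bot] at this
  have hinf : ∀ A ∈ S, ∀ B ∈ S, A ⊓ B ∈ S := by
    rintro A ⟨hA, hAn, hAc⟩ B ⟨hB, hBn, hBc⟩
    refine ⟨fun h => hd ?_, inferInstance, hAc.inter hBc⟩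
    refine hUF.discreteTopology_of_centralizer hF hU fun f _ => Filter.Eventually.of_forall
      fun v => hψ.injective ?_
    rw [map_mul, map_mul]
    refine commute_of_mem_closure ?_ (hden A hAn hA _) (hden B hBn hB _)
    rintro _ ⟨a, ha, rfl⟩ _ ⟨b, hb, rfl⟩
    rw [← map_mul, ← map_mul, commute_of_normal_of_inf_eq_bot hAn hBn h ha hb]
  -- The non-trivial closed normal subgroups form a directed family.
  intro hdisc
  have hmon : monolith H = ⨅ N : S, (N : Subgroup H) := sInf_eq_iInf' _
  rw [hmon] at hdisc
  have : Nonempty S := ⟨⟨⊤, htop⟩⟩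
  obtain ⟨⟨N, hN, hNn, hNc⟩, hNd⟩ := hUF.exists_discrete_of_directed hF hU
    (fun N : S => (N : Subgroup H)) (fun N => N.2.2.2)
    (fun A B => ⟨⟨A ⊓ B, hinf A A.2 B B.2⟩, inf_le_left, inf_le_right⟩)
    (fun N f _ x hx => ⟨by simpa using N.2.2.1.conj_mem x hx f⁻¹, N.2.2.1.conj_mem x hx f⟩) hdisc
  exact hN (le_bot_iff.1 (hqc ▸ le_quasiCenter_of_discrete hNn hNd))

/-- The monolith of the monolith `L` of `H` is non-trivial, since `L` is itself a non-discrete dense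
locally compact subgroup of `G`; being characteristic in `L`, it is all of `L`. -/
theorem IsDenseGroupEmbedding.isTopologicallySimple_monolith
    {φ : monolith H →* G} (hφ : IsDenseGroupEmbedding φ) [IsTopologicalGroup H]
    (hG : IsTDLC G) (he : IsRegionallyExpansive G) (hs : IsTopologicallySimple G)
    (hd : ¬ DiscreteTopology (monolith H)) : IsTopologicallySimple (monolith H) := by
  have hm := hφ.not_discreteTopology_monolith hG he hs hd
  have hne : monolith (monolith H) ≠ ⊥ := fun h => hm (by rw [h]; infer_instance)
  have hnorm : ((monolith (monolith H)).map (monolith H).subtype).Normal := by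
    refine ⟨?_⟩
    rintro _ ⟨x, hx, rfl⟩ h
    let e : monolith H ≃ₜ* monolith H :=
      { MulAut.conjNormal h with
        continuous_toFun := by
          refine Continuous.subtype_mk (f := fun x : monolith H => h * x * h⁻¹) (by fun_prop) _
        continuous_invFun := by
          refine Continuous.subtype_mk (f := fun x : monolith H => h⁻¹ * x * h⁻¹⁻¹) (by fun_prop) _ }
    exact ⟨e x, map_mem_monolith e hx, rfl⟩
  have hle := monolith_le (fun h => hne ((Subgroup.map_eq_bot_iff_of_injective _
    (monolith H).subtype_injective).1 h)) hnorm
    (isClosed_monolith.isClosedMap_subtype_val _ isClosed_monolith)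
  have htop : monolith (monolith H) = ⊤ := by
    refine eq_top_iff.2 fun x _ => ?_
    obtain ⟨y, hy, hyx⟩ := hle x.2
    rwa [← Subtype.ext hyx]
  refine ⟨?_, fun N hN hNc => or_iff_not_imp_left.2 fun hNe => ?_⟩
  · by_contra hn
    rw [not_nontrivial_iff_subsingleton] at hn
    exact hd inferInstance
  · exact top_le_iff.1 (htop ▸ monolith_le hNe hN hNc)

end DenseEmbedding

/-! ### Robustly monolithic groups -/

section Robust

variable {G : Type u} [Group G] [TopologicalSpace G]

theorem IsRobustlyMonolithic.isTDLC_monolith (hG : IsRobustlyMonolithic G) :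
    IsTDLC (monolith G) :=
  hG.isTDLC.subgroup isClosed_monolith

theorem IsRobustlyMonolithic.quasiCenter_monolith (hG : IsRobustlyMonolithic G) :
    quasiCenter (monolith G) = ⊥ :=
  (IsDenseGroupEmbedding.id hG.isTDLC_monolith).quasiCenter_eq_bot hG.isTDLC_monolith
    hG.isRegionallyExpansive hG.isTopologicallySimple hG.not_discrete

theorem IsRobustlyMonolithic.not_commutative_monolith (hG : IsRobustlyMonolithic G)
    (h : ∀ a ∈ monolith G, ∀ b ∈ monolith G, a * b = b * a) : False := by
  have hq := hG.quasiCenter_monolith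
  refine hG.isMonolithic ((Subgroup.eq_bot_iff_forall _).2 fun x hx => ?_)
  have : (⟨x, hx⟩ : monolith G) ∈ quasiCenter (monolith G) :=
    Filter.Eventually.of_forall fun v => Subtype.ext (h v v.2 x hx)
  rw [hq, Subgroup.mem_bot] at this
  exact congrArg Subtype.val this

/-- Open subgroups of the monolith have trivial centraliser. -/
theorem IsRobustlyMonolithic.eq_one_of_commute (hG : IsRobustlyMonolithic G) {x : G}
    (hx : ∀ᶠ v in 𝓝 (1 : G), v ∈ monolith G → v * x = x * v) : x = 1 := by
  have := hG.isTDLC.isTopologicalGroup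
  have := hG.isTDLC.t2Space
  have hxM : ∀ᶠ v : monolith G in 𝓝 1, (v : G) * x = x * v := by
    have : Filter.Tendsto ((↑) : monolith G → G) (𝓝 1) (𝓝 1) :=
      continuous_subtype_val.tendsto (1 : monolith G)
    filter_upwards [this.eventually hx] with v hv using hv v.2
  -- The commutators of `x` with the monolith are quasi-central in the monolith.
  have hcomm : ∀ g ∈ monolith G, x * g = g * x := by
    intro g hg
    let c : monolith G := ⟨x * g * x⁻¹ * g⁻¹,
      mul_mem (monolith_normal.conj_mem g hg x) (inv_mem hg)⟩
    have hc : c ∈ quasiCenter (monolith G) := by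
      have ht : Filter.Tendsto (fun v : monolith G => (⟨g, hg⟩ : monolith G)⁻¹ * v * ⟨g, hg⟩)
          (𝓝 1) (𝓝 1) := by
        have : Continuous fun v : monolith G => (⟨g, hg⟩ : monolith G)⁻¹ * v * ⟨g, hg⟩ := by
          fun_prop
        simpa using this.tendsto 1
      change ∀ᶠ v in 𝓝 1, v * c = c * v
      filter_upwards [hxM, ht.eventually hxM] with v h1 h2
      apply Subtype.ext
      simp only [Subgroup.coe_mul, InvMemClass.coe_inv] at h2
      have h3 : x⁻¹ * (g⁻¹ * v * g) = g⁻¹ * v * g * x⁻¹ := by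
        rw [eq_mul_inv_iff_mul_eq, mul_assoc, h2, inv_mul_cancel_left]
      calc (v : G) * (x * g * x⁻¹ * g⁻¹) = v * x * g * x⁻¹ * g⁻¹ := by simp only [mul_assoc]
        _ = x * g * (g⁻¹ * v * g * x⁻¹) * g⁻¹ := by rw [h1]; simp [mul_assoc]
        _ = x * g * x⁻¹ * g⁻¹ * v := by rw [← h3]; simp [mul_assoc]
    rw [hG.quasiCenter_monolith, Subgroup.mem_bot] at hc
    have : x * g * x⁻¹ * g⁻¹ = 1 := congrArg Subtype.val hc
    rwa [mul_inv_eq_one, mul_inv_eq_iff_eq_mul] at this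
  by_contra hx1
  have hle : monolith G ≤ Subgroup.centralizer (monolith G : Set G) := by
    refine monolith_le (fun h => hx1 ?_) inferInstance (Set.isClosed_centralizer _)
    have : x ∈ Subgroup.centralizer (monolith G : Set G) :=
      Subgroup.mem_centralizer_iff.2 fun g hg => (hcomm g hg).symm
    rwa [h, Subgroup.mem_bot] at this
  exact hG.not_commutative_monolith fun a ha b hb =>
    (Subgroup.mem_centralizer_iff.1 (hle ha) b hb).symm

/-- A compact open subgroup has trivial core in the group it generates together with suitable
finitely many elements of the monolith. -/
theorem IsRobustlyMonolithic.exists_finite_subset_monolith (hG : IsRobustlyMonolithic G) :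
    ∃ (W : Subgroup G) (F : Set G), IsOpen (W : Set G) ∧ IsCompact (W : Set G) ∧ F.Finite ∧
      F ⊆ monolith G ∧ ∀ x : G, (∀ g ∈ Subgroup.closure (W ∪ F), g⁻¹ * x * g ∈ W) → x = 1 := by
  obtain ⟨_, _, _, _⟩ := hG.isTDLC
  obtain ⟨V, F, hVo, -, hF, hVF⟩ := hG.isRegionallyExpansive.exists_isExpansivePair
  obtain ⟨O, hO, hOV⟩ := isOpen_induced_iff.1 hVo
  have h1O : (1 : G) ∈ O := by
    have : (1 : monolith G) ∈ Subtype.val ⁻¹' O := by rw [hOV]; exact V.one_mem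
    exact this
  obtain ⟨W, hWo, hWc, hWO⟩ := exists_compact_open_subgroup_subset (hO.mem_nhds h1O)
  refine ⟨W, Subtype.val '' F, hWo, hWc, hF.image _, ?_, fun x hx => ?_⟩
  · rintro _ ⟨f, _, rfl⟩; exact f.2
  refine hG.eq_one_of_commute ?_
  filter_upwards [hWo.mem_nhds W.one_mem] with v hvW hvM
  let c : monolith G := ⟨v * (x * v⁻¹ * x⁻¹),
    mul_mem hvM (monolith_normal.conj_mem _ (inv_mem hvM) x)⟩
  have hc : c = 1 := by
    refine hVF c fun d hd => ?_
    have hdO : (d : G) ∈ Subgroup.closure ((W : Set G) ∪ Subtype.val '' F) := by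
      refine Subgroup.closure_mono Set.subset_union_right ?_
      have : Subgroup.closure (Subtype.val '' F) =
        (Subgroup.closure F).map (monolith G).subtype := by rw [MonoidHom.map_closure]; rfl
      rw [this]
      exact ⟨d, hd, rfl⟩
    have h1 := hx _ (mul_mem (inv_mem (Subgroup.subset_closure (Or.inl hvW))) hdO)
    have h2 := W.inv_mem (hx _ hdO)
    have h3 : d⁻¹ * c * d ∈ Subtype.val ⁻¹' O := by
      refine hWO ?_
      have := W.mul_mem h1 h2
      simpa [c, mul_assoc] using this
    rwa [hOV] at h3
  have : v * (x * v⁻¹ * x⁻¹) = 1 := congrArg Subtype.val hc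
  rw [← mul_assoc, ← mul_assoc, mul_inv_eq_one, mul_inv_eq_iff_eq_mul] at this
  exact this

theorem IsRobustlyMonolithic.isRegionallyExpansive_self (hG : IsRobustlyMonolithic G) :
    IsRegionallyExpansive G := by
  have := hG.isTDLC.isTopologicalGroup
  obtain ⟨W, F, hWo, hWc, hF, -, hWF⟩ := hG.exists_finite_subset_monolith
  obtain ⟨F', -, hF', -, h⟩ := exists_isExpansivePair_dense hWo hWc hF hWF dense_univ
  exact h.isRegionallyExpansive hWo hWc hF'

variable {H : Type v} [Group H] [TopologicalSpace H] {ψ : H →* G}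

/-- A non-discrete dense locally compact subgroup of a robustly monolithic group meets the monolith
in a non-discrete group. With `W` and `F` as in `exists_finite_subset_monolith`, an expansive pair
of `H` can be found inside `⟨W ∪ F⟩`, which normalises `M W'` for each open normal subgroup `W'`
of `W`, where `M` is the monolith. These subgroups are open and intersect in `M`. -/
theorem IsRobustlyMonolithic.not_discreteTopology_comap_monolith (hG : IsRobustlyMonolithic G)
    (hψ : IsDenseGroupEmbedding ψ) (hd : ¬ DiscreteTopology H) :
    ¬ DiscreteTopology ((monolith G).comap ψ) := by
  obtain ⟨W, F, hWo, hWc, hF, hFM, hWF⟩ := hG.exists_finite_subset_monolith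
  obtain ⟨_, _, _, _⟩ := hψ.isTDLC hG.isTDLC
  have hG' := hG.isTDLC
  obtain ⟨_, _, _, _⟩ := hG.isTDLC
  obtain ⟨F₁, hF₁r, hF₁, hF₁O, hWF₁⟩ := exists_isExpansivePair_dense hWo hWc hF hWF hψ.denseRange
  obtain ⟨U, F₂, hU, hUc, hF₂, -, hF₂₁, hUF₂⟩ := hψ.exists_isExpansivePair_of_subset_range hG'
    hWo hF₁ hWF₁ (D := Set.univ) (by rwa [Set.image_univ])
  let S := {V : Subgroup G | IsOpen (V : Set G) ∧ ∀ w ∈ W, ∀ x ∈ V, w * x * w⁻¹ ∈ V}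
  let N : S → Subgroup H := fun V => (monolith G ⊔ V).comap ψ
  have hNo : ∀ V, IsOpen (N V : Set H) := fun V =>
    (Subgroup.isOpen_mono le_sup_right V.2.1).preimage hψ.continuous
  have hconj : ∀ V : S, ∀ g ∈ Subgroup.closure (W ∪ F), ∀ x ∈ monolith G ⊔ (V : Subgroup G),
      g * x * g⁻¹ ∈ monolith G ⊔ (V : Subgroup G) := by
    intro V
    rw [← Subgroup.le_normalizer_iff, Subgroup.closure_le]
    rintro g (hg | hg)
    · intro x
      have hW : ∀ w ∈ W, ∀ x ∈ monolith G ⊔ (V : Subgroup G),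
          w * x * w⁻¹ ∈ monolith G ⊔ (V : Subgroup G) := by
        intro w hw x hx
        obtain ⟨m, hm, y, hy, rfl⟩ := Subgroup.mem_sup_of_normal_left.1 hx
        refine Subgroup.mem_sup_of_normal_left.2 ⟨w * m * w⁻¹, monolith_normal.conj_mem m hm w,
          w * y * w⁻¹, V.2.2 w hw y hy, by simp⟩
      exact ⟨fun hx => hW g hg x hx, fun hx => by
        simpa [mul_assoc] using hW g⁻¹ (W.inv_mem hg) _ hx⟩
    · exact Subgroup.le_normalizer (Subgroup.mem_sup_left (hFM hg))
  have hneb : ∀ O ∈ 𝓝 (1 : G), ∃ V : S, ((V : Subgroup G) : Set G) ⊆ O := by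
    intro O hO
    obtain ⟨V, hV, -, hVO, hVW⟩ := exists_compact_open_subgroup_normalized hWc hO
    exact ⟨⟨V, hV, hVW⟩, hVO⟩
  have : Nonempty S := ⟨⟨⊤, isOpen_univ, fun _ _ _ _ => Subgroup.mem_top _⟩⟩
  intro hdisc
  have hiInf : ⨅ V, N V = (monolith G).comap ψ := by
    refine le_antisymm (fun x hx => ?_) (le_iInf fun V => Subgroup.comap_mono le_sup_left)
    by_contra hxM
    have : (fun y => y⁻¹ * ψ x) ⁻¹' (monolith G : Set G)ᶜ ∈ 𝓝 (1 : G) :=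
      (isClosed_monolith.isOpen_compl.preimage (by fun_prop)).mem_nhds (by simpa using hxM)
    obtain ⟨V, hV⟩ := hneb _ this
    have hxV : ψ x ∈ monolith G ⊔ (V : Subgroup G) := Subgroup.mem_iInf.1 hx V
    rw [sup_comm] at hxV
    obtain ⟨y, hy, m, hm, hym⟩ := Subgroup.mem_sup_of_normal_right.1 hxV
    exact hV hy (by simpa [← hym] using hm)
  obtain ⟨V, hV⟩ := hUF₂.exists_discrete_of_directed hF₂ hU N
    (fun V => Subgroup.isClosed_of_isOpen _ (hNo V))
    (fun A B => ⟨⟨A ⊓ B, A.2.1.inter B.2.1, fun w hw x hx =>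
        ⟨A.2.2 w hw x hx.1, B.2.2 w hw x hx.2⟩⟩,
      Subgroup.comap_mono (sup_le_sup_left inf_le_left _),
      Subgroup.comap_mono (sup_le_sup_left inf_le_right _)⟩)
    (fun V f hf x hx => by
      have hfO := hF₁O (hF₂₁ ▸ Set.mem_image_of_mem ψ hf)
      have h1 := hconj V _ hfO _ hx
      have h2 := hconj V _ (inv_mem hfO) _ hx
      exact ⟨by simpa [N] using h2, by simpa [N] using h1⟩) (hiInf ▸ hdisc)
  obtain ⟨O, hO, hO1⟩ := discreteTopology_subgroup_iff.1 hV
  exact hd (discreteTopology_of_nhds (Filter.inter_mem ((hNo V).mem_nhds (N V).one_mem) hO)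
    fun x hx => hO1 x hx.1 hx.2)

/-- The restriction of `ψ` to a normal subgroup of `H` that maps into the monolith of `G` is a dense
embedding into the monolith. -/
theorem IsDenseGroupEmbedding.restrict_monolith (hψ : IsDenseGroupEmbedding ψ) (hG : IsTDLC G)
    {N : Subgroup H} (hN : N.Normal) (hNc : IsClosed (N : Set H)) (hne : N ≠ ⊥)
    (φ : N →* monolith G) (hφ : ∀ x, (φ x : G) = ψ x) : IsDenseGroupEmbedding φ := by
  have hH := (hψ.isTDLC hG).subgroup hNc
  have := hG.isTopologicalGroup
  refine ⟨hH.isTopologicalGroup, hH.t2Space, hH.locallyCompactSpace, ?_, fun x y h => ?_, ?_⟩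
  · rw [continuous_induced_rng]
    exact (hψ.continuous.comp continuous_subtype_val).congr fun x => (hφ x).symm
  · exact Subtype.ext (hψ.injective (by rw [← hφ, ← hφ, h]))
  · intro y
    rw [closure_subtype]
    refine closure_mono ?_ (hψ.monolith_le_closure hN hne y.2)
    rintro _ ⟨x, hx, rfl⟩
    exact ⟨φ ⟨x, hx⟩, ⟨_, rfl⟩, hφ _⟩

/-- The class of robustly monolithic groups is stable under passing to non-discrete dense locally
compact subgroups, and the dense embedding restricts to the monoliths. -/
theorem IsRobustlyMonolithic.of_isDenseGroupEmbedding (hG : IsRobustlyMonolithic G)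
    (hψ : IsDenseGroupEmbedding ψ) (hd : ¬ DiscreteTopology H) :
    IsRobustlyMonolithic H ∧
      ∃ φ : monolith H →* monolith G, (∀ x, (φ x : G) = ψ x) ∧ IsDenseGroupEmbedding φ := by
  have hH := hψ.isTDLC hG.isTDLC
  obtain ⟨_, _, _, _⟩ := hψ.isTDLC hG.isTDLC
  obtain ⟨_, _, _, _⟩ := hG.isTDLC
  set K := (monolith G).comap ψ with hK
  have hKd : ¬ DiscreteTopology K := hG.not_discreteTopology_comap_monolith hψ hd
  have hKc : IsClosed (K : Set H) := isClosed_monolith.preimage hψ.continuous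
  have hKb : K ≠ ⊥ := fun h => hKd (by rw [h]; infer_instance)
  have hKe : IsDenseGroupEmbedding (ψ.subgroupComap (monolith G)) :=
    hψ.restrict_monolith hG.isTDLC inferInstance hKc hKb _ fun _ => rfl
  have hKm := hKe.not_discreteTopology_monolith hG.isTDLC_monolith hG.isRegionallyExpansive
    hG.isTopologicallySimple hKd
  -- Non-trivial closed normal subgroups of `H` meet `K` non-trivially.
  have hle : ∀ x : K, x ∈ monolith K → (x : H) ∈ monolith H := by
    refine fun x hx => mem_monolith_iff.2 fun N hN hNn hNc => ?_
    refine mem_monolith_iff.1 hx (N.subgroupOf K) (fun h => ?_) inferInstance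
      (hNc.preimage continuous_subtype_val)
    have hinf : N ⊓ K = ⊥ := by
      rwa [Subgroup.subgroupOf_eq_bot, disjoint_iff] at h
    refine hG.not_commutative_monolith fun a ha b hb => ?_
    refine commute_of_mem_closure ?_ (hψ.monolith_le_closure hNn hN ha)
      (hψ.monolith_le_closure inferInstance hKb hb)
    rintro _ ⟨a, ha, rfl⟩ _ ⟨b, hb, rfl⟩
    rw [← map_mul, ← map_mul, commute_of_normal_of_inf_eq_bot hNn inferInstance hinf ha hb]
  have hmd : ¬ DiscreteTopology (monolith H) := by
    intro h
    let f : monolith K → monolith H := fun x => ⟨x, hle x x.2⟩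
    have hf : Continuous f :=
      (continuous_subtype_val.comp continuous_subtype_val).subtype_mk _
    exact hKm (DiscreteTopology.of_continuous_injective hf fun x y hxy =>
      Subtype.ext (Subtype.ext (congrArg (fun z : monolith H => (z : H)) hxy)))
  have hmb : monolith H ≠ ⊥ := fun h => hmd (by rw [h]; infer_instance)
  have hmK : monolith H ≤ K := monolith_le hKb inferInstance hKc
  let φ : monolith H →* monolith G := (ψ.subgroupComap (monolith G)).comp (Subgroup.inclusion hmK)
  have hφ : IsDenseGroupEmbedding φ :=
    hψ.restrict_monolith hG.isTDLC inferInstance isClosed_monolith hmb _ fun _ => rfl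
  refine ⟨⟨hH, hmb, hmd, ?_, ?_⟩, φ, fun _ => rfl, hφ⟩
  · exact hφ.isRegionallyExpansive hG.isTDLC_monolith hG.isRegionallyExpansive
  · exact hφ.isTopologicallySimple_monolith hG.isTDLC_monolith hG.isRegionallyExpansive
      hG.isTopologicallySimple hmd

end Robust

/-! ### Pro-`π` groups -/

section Index

variable {P : Type*} [Group P]

theorem mem_map_conj_iff {S : Subgroup P} {g x : P} :
    x ∈ S.map (MulAut.conj g).toMonoidHom ↔ g⁻¹ * x * g ∈ S := by
  constructor
  · rintro ⟨y, hy, rfl⟩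
    simpa [mul_assoc] using hy
  · exact fun h => ⟨_, h, by simp [mul_assoc]⟩

end Index

section ProPi

variable {π : Set ℕ}

/-- A compact group that embeds continuously into a pro-`π` group is pro-`π`. -/
theorem IsProPi.of_injective {P Q : Type*} [Group P] [TopologicalSpace P] [Group Q]
    [TopologicalSpace Q] [IsTopologicalGroup Q] [CompactSpace Q] (hP : IsProPi π P)
    {f : Q →* P} (hf : Continuous f) (hinj : Function.Injective f) : IsProPi π Q := by
  obtain ⟨_, _, _, _, hπ⟩ := hP
  have hemb := hf.isClosedEmbedding hinj
  refine ⟨‹_›, hemb.isEmbedding.t2Space, ‹_›, ⟨isTotallyDisconnected_of_image hf.continuousOn hinj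
    (isTotallyDisconnected_of_totallyDisconnectedSpace _)⟩, fun N hN hNo q hq hqN => ?_⟩
  obtain ⟨O, hO, hON⟩ := hemb.isInducing.isOpen_iff.1 hNo
  have h1 : (1 : P) ∈ O := by
    have : (1 : Q) ∈ f ⁻¹' O := by rw [hON]; exact N.one_mem
    simpa using this
  obtain ⟨M, hMO⟩ := ProfiniteGrp.exist_openNormalSubgroup_sub_open_nhds_of_one hO h1
  have hMN : (M : Subgroup P).comap f ≤ N := fun x hx => by
    have : x ∈ f ⁻¹' O := hMO hx
    rwa [hON] at this
  refine hπ M inferInstance M.isOpen' q hq (hqN.trans ((Subgroup.index_dvd_of_le hMN).trans ?_))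
  rw [Subgroup.index_comap]
  exact Subgroup.relIndex_dvd_index_of_normal _ _

variable {G : Type*} [Group G] [TopologicalSpace G]

theorem IsProPi.isCompact {S : Subgroup G} (h : IsProPi π S) : IsCompact (S : Set G) :=
  isCompact_iff_compactSpace.2 h.compactSpace

theorem IsProPi.map {G' : Type*} [Group G'] [TopologicalSpace G'] [IsTopologicalGroup G']
    [T2Space G'] {S : Subgroup G} (hS : IsProPi π S) {f : G →* G'} (hf : Continuous f)
    (hinj : Function.Injective f) : IsProPi π (S.map f) := by
  have := hS.compactSpace
  have : CompactSpace (S.map f) := isCompact_iff_compactSpace.1 (hS.isCompact.image hf)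
  let e := S.equivMapOfInjective f hinj
  have he : Continuous e.toEquiv := (hf.comp continuous_subtype_val).subtype_mk _
  exact hS.of_injective (f := (e.symm : S.map f →* S))
    (Continuous.homeoOfEquivCompactToT2 he).symm.continuous e.symm.injective

variable [IsTopologicalGroup G]

theorem IsProPi.of_le {S T : Subgroup G} (hS : IsProPi π S) (hT : IsClosed (T : Set G))
    (hTS : T ≤ S) : IsProPi π T := by
  have : CompactSpace T := isCompact_iff_compactSpace.1 (hS.isCompact.of_isClosed_subset hT hTS)
  exact hS.of_injective (f := Subgroup.inclusion hTS) (continuous_inclusion hTS)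
    (Subgroup.inclusion_injective hTS)

theorem IsProPi.comap {G' : Type*} [Group G'] [TopologicalSpace G'] [IsTopologicalGroup G']
    [CompactSpace G] [T2Space G'] {S : Subgroup G'} (hS : IsProPi π S) {f : G →* G'}
    (hf : Continuous f) (hinj : Function.Injective f) : IsProPi π (S.comap f) := by
  have : CompactSpace (S.comap f) :=
    isCompact_iff_compactSpace.1 (hS.isCompact.isClosed.preimage hf).isCompact
  exact hS.of_injective (f := f.subgroupComap S)
    ((hf.comp continuous_subtype_val).subtype_mk _)
    fun x y h => Subtype.ext (hinj (congrArg (fun z : S => (z : G')) h))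

theorem IsProPi.conj [T2Space G] {S : Subgroup G} (hS : IsProPi π S) (g : G) :
    IsProPi π (S.map (MulAut.conj g).toMonoidHom) :=
  hS.map (by change Continuous fun x => g * x * g⁻¹; fun_prop) (MulAut.conj g).injective

/-- A prime for which there is an infinite pro-`p` group that is also pro-`π` belongs to `π`. -/
theorem IsProPi.mem_of_infinite {P : Type*} [Group P] [TopologicalSpace P] {p : ℕ}
    (hp : IsProPi {p} P) (hπ : IsProPi π P) (hinf : Infinite P) : p ∈ π := by
  obtain ⟨_, _, _, _, hp⟩ := hp
  obtain ⟨x, hx⟩ := exists_ne (1 : P)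
  obtain ⟨N, hN⟩ := ProfiniteGrp.exist_openNormalSubgroup_sub_open_nhds_of_one
    (isOpen_compl_singleton (x := x)) (by simpa using hx.symm)
  have h1 : (N : Subgroup P).index ≠ 1 := fun h => by
    rw [Subgroup.index_eq_one] at h
    have : x ∈ (N : Subgroup P) := h ▸ Subgroup.mem_top x
    exact hN this rfl
  obtain ⟨q, hq, hqN⟩ := Nat.exists_prime_and_dvd h1
  have h2 := hp N inferInstance N.isOpen' q hq hqN
  have h3 := hπ.index_mem N inferInstance N.isOpen' q hq hqN
  rwa [Set.mem_singleton_iff.1 h2] at h3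

end ProPi

/-! ### Sylow theory of profinite groups -/

section Index

variable {P : Type*} [Group P]

theorem relIndex_sup_of_le {M K : Subgroup P} [M.Normal] (S : Subgroup P) (h : M ≤ K) :
    K.relIndex (S ⊔ M) = K.relIndex S := by
  have hK : (K.map (QuotientGroup.mk' M)).comap (QuotientGroup.mk' M) = K := by
    rw [Subgroup.comap_map_eq, QuotientGroup.ker_mk', sup_eq_left.2 h]
  have hM : M.map (QuotientGroup.mk' M) = ⊥ := by
    rw [Subgroup.map_eq_bot_iff, QuotientGroup.ker_mk']
  conv_lhs => rw [← hK, Subgroup.relIndex_comap, Subgroup.map_sup, hM, sup_bot_eq]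
  conv_rhs => rw [← hK, Subgroup.relIndex_comap]

theorem relIndex_dvd_relIndex_of_normal {N A B : Subgroup P} [N.Normal] (h : A ≤ B) :
    N.relIndex A ∣ N.relIndex B := by
  have hk : ∀ C : Subgroup P, N.relIndex C = Nat.card (C.map (QuotientGroup.mk' N)) := fun C => by
    rw [← Subgroup.relIndex_ker, QuotientGroup.ker_mk']
  rw [hk, hk]
  exact Subgroup.card_dvd_of_le (Subgroup.map_mono h)

end Index

section Sylow

variable {P : Type*} [Group P] [TopologicalSpace P] [IsTopologicalGroup P] [CompactSpace P]

theorem index_ne_zero_of_isOpen {N : Subgroup P} (hN : IsOpen (N : Set P)) : N.index ≠ 0 := by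
  have := N.quotient_finite_of_isOpen hN
  exact Subgroup.index_ne_zero_of_finite

variable [TotallyDisconnectedSpace P]

theorem mem_of_forall_mem_sup {T : Subgroup P} (hT : IsClosed (T : Set P)) {x : P}
    (h : ∀ N : OpenNormalSubgroup P, x ∈ T ⊔ (N : Subgroup P)) : x ∈ T := by
  by_contra hx
  obtain ⟨N, hN⟩ := ProfiniteGrp.exist_openNormalSubgroup_sub_open_nhds_of_one
    (hT.isOpen_compl.preimage (by fun_prop : Continuous fun y => x * y⁻¹)) (by simpa using hx)
  obtain ⟨t, ht, n, hn, rfl⟩ := Subgroup.mem_sup_of_normal_right.1 (h N)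
  exact hN hn (by simpa using ht)

variable [T2Space P]

theorem isProPi_subgroup_iff {π : Set ℕ} {T : Subgroup P} (hT : IsClosed (T : Set P)) :
    IsProPi π T ↔ ∀ N : OpenNormalSubgroup P, ∀ q : ℕ, q.Prime →
      q ∣ (N : Subgroup P).relIndex T → q ∈ π := by
  constructor
  · intro h N q hq hqN
    exact h.index_mem ((N : Subgroup P).subgroupOf T) inferInstance
      (N.isOpen'.preimage continuous_subtype_val) q hq hqN
  · intro h
    refine ⟨inferInstance, inferInstance, isCompact_iff_compactSpace.1 hT.isCompact, inferInstance,
      fun N hN hNo q hq hqN => ?_⟩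
    obtain ⟨O, hO, hON⟩ := isOpen_induced_iff.1 hNo
    have h1 : (1 : P) ∈ O := by
      have : (1 : T) ∈ Subtype.val ⁻¹' O := by rw [hON]; exact N.one_mem
      exact this
    obtain ⟨M, hMO⟩ := ProfiniteGrp.exist_openNormalSubgroup_sub_open_nhds_of_one hO h1
    refine h M q hq (hqN.trans (Subgroup.index_dvd_of_le fun x hx => ?_))
    have : x ∈ Subtype.val ⁻¹' O := hMO hx
    rwa [hON] at this

/-- Closed pro-`p` subgroups whose index is prime to `p`, in the sense that they map onto Sylow
subgroups of all finite continuous quotients. -/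
structure IsProfiniteSylow (p : ℕ) (T : Subgroup P) : Prop where
  isClosed : IsClosed (T : Set P)
  isProPi : IsProPi {p} T
  not_dvd : ∀ N : OpenNormalSubgroup P, ¬ p ∣ (T ⊔ (N : Subgroup P)).index

/-- A closed subgroup that is minimal among those of index prime to `p` is pro-`p`. -/
theorem exists_isProfiniteSylow (p : ℕ) [hp : Fact p.Prime] :
    ∃ T : Subgroup P, IsProfiniteSylow p T := by
  let 𝒮 : Set (Subgroup P)ᵒᵈ := {T | IsClosed ((OrderDual.ofDual T : Subgroup P) : Set P) ∧
    ∀ N : OpenNormalSubgroup P, ¬ p ∣ (OrderDual.ofDual T ⊔ (N : Subgroup P)).index}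
  obtain ⟨S, ⟨hSc, hSp⟩, hmax⟩ := zorn_le₀ 𝒮 (fun c hc hchain => by
    rcases c.eq_empty_or_nonempty with rfl | hne
    · refine ⟨OrderDual.toDual ⊤, ⟨isClosed_univ, fun N => ?_⟩, by simp⟩
      simpa using hp.out.one_lt.ne'
    have : Nonempty c := hne.to_subtype
    let I : Subgroup P := ⨅ T : c, OrderDual.ofDual (T : (Subgroup P)ᵒᵈ)
    have hIle : ∀ T : c, I ≤ OrderDual.ofDual (T : (Subgroup P)ᵒᵈ) := fun T => iInf_le _ T
    refine ⟨OrderDual.toDual I, ⟨?_, fun N => ?_⟩, fun T hT => hIle ⟨T, hT⟩⟩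
    · change IsClosed (I : Set P)
      rw [Subgroup.coe_iInf]
      exact isClosed_iInter fun T => (hc T.2).1
    · change ¬ p ∣ (I ⊔ (N : Subgroup P)).index
      have hopen : IsOpen ((I ⊔ (N : Subgroup P) : Subgroup P) : Set P) :=
        Subgroup.isOpen_mono le_sup_right N.isOpen'
      obtain ⟨T, hT⟩ := exists_inter_subset_of_directed isCompact_univ hopen
        (fun T : c => ((OrderDual.ofDual (T : (Subgroup P)ᵒᵈ) : Subgroup P) : Set P))
        (fun T => (hc T.2).1) (fun A B => by
          rcases hchain.total A.2 B.2 with h | h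
          · exact ⟨B, h, subset_rfl⟩
          · exact ⟨A, subset_rfl, h⟩) (by
        rw [Set.univ_inter, ← Subgroup.coe_iInf]
        exact SetLike.coe_subset_coe.2 le_sup_left)
      rw [Set.univ_inter] at hT
      have heq : I ⊔ (N : Subgroup P) = OrderDual.ofDual (T : (Subgroup P)ᵒᵈ) ⊔ N :=
        le_antisymm (sup_le_sup_right (hIle T) _) (sup_le hT le_sup_right)
      rw [heq]
      exact (hc T.2).2 N)
  obtain ⟨S, rfl⟩ := OrderDual.toDual.surjective S
  change IsClosed (S : Set P) at hSc
  change ∀ N : OpenNormalSubgroup P, ¬ p ∣ (S ⊔ (N : Subgroup P)).index at hSp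
  refine ⟨S, hSc, (isProPi_subgroup_iff hSc).2 fun N q hq hqN => ?_, hSp⟩
  have : CompactSpace S := isCompact_iff_compactSpace.1 hSc.isCompact
  have hNo : IsOpen (((N : Subgroup P).subgroupOf S : Subgroup S) : Set S) :=
    N.isOpen'.preimage continuous_subtype_val
  have : Finite (S ⧸ (N : Subgroup P).subgroupOf S) := Subgroup.quotient_finite_of_isOpen _ hNo
  obtain ⟨R⟩ : Nonempty (Sylow p (S ⧸ (N : Subgroup P).subgroupOf S)) := inferInstance
  set f := QuotientGroup.mk' ((N : Subgroup P).subgroupOf S) with hf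
  have hfs : Function.Surjective f := QuotientGroup.mk'_surjective _
  -- The preimage of a Sylow subgroup of `S / (S ∩ N)` still has index prime to `p`.
  let A : Subgroup S := R.toSubgroup.comap f
  have hAo : IsOpen (A : Set S) := by
    refine Subgroup.isOpen_mono (fun x hx => ?_) hNo
    have : f x = 1 := (QuotientGroup.eq_one_iff x).2 hx
    simp [A, this, one_mem]
  have hAle : A.map S.subtype ≤ S := by rintro _ ⟨x, -, rfl⟩; exact x.2
  have hAi : (A.map S.subtype).relIndex S = R.toSubgroup.index := by
    rw [← Subgroup.index_comap_of_surjective R.toSubgroup hfs, Subgroup.relIndex, Subgroup.subgroupOf,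
      Subgroup.comap_map_eq_self_of_injective S.subtype_injective]
  have hA : OrderDual.toDual (A.map S.subtype) ∈ 𝒮 := by
    refine ⟨?_, fun M => ?_⟩
    · exact hSc.isClosedMap_subtype_val _ (A.isClosed_of_isOpen hAo)
    · change ¬ p ∣ (A.map S.subtype ⊔ (M : Subgroup P)).index
      rw [← Subgroup.relIndex_mul_index (sup_le_sup_right hAle (M : Subgroup P)), hp.out.dvd_mul,
        not_or]
      refine ⟨fun h => ?_, hSp M⟩
      rw [relIndex_sup_of_le _ le_sup_right] at h
      have := h.trans (Subgroup.relIndex_dvd_of_le_left S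
        (le_sup_left : A.map S.subtype ≤ A.map S.subtype ⊔ (M : Subgroup P)))
      rw [hAi] at this
      exact R.not_dvd_index this
  have hSA : S ≤ A.map S.subtype := hmax hA hAle
  have hR : R.toSubgroup = ⊤ := by
    rw [← Subgroup.index_eq_one, ← hAi, Subgroup.relIndex_eq_one]; exact hSA
  obtain ⟨n, hn⟩ := IsPGroup.iff_card.1 R.2
  rw [hR, Subgroup.card_top] at hn
  have : (N : Subgroup P).relIndex S = p ^ n := by
    rw [← hn, Subgroup.relIndex, Subgroup.index_eq_card]
  rw [this] at hqN
  exact (Nat.prime_dvd_prime_iff_eq hq hp.out).1 (hq.dvd_of_dvd_pow hqN)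

variable {p : ℕ}

theorem exists_relIndex_eq_pow {Q : Subgroup P} (hQ : IsProPi {p} Q) (N : OpenNormalSubgroup P) :
    ∃ n, (N : Subgroup P).relIndex Q = p ^ n := by
  refine ⟨_, Nat.eq_prime_pow_of_unique_prime_dvd (fun h => ?_) fun {q} hq hqN =>
    (isProPi_subgroup_iff hQ.isCompact.isClosed).1 hQ N q hq hqN⟩
  exact index_ne_zero_of_isOpen N.isOpen' (Subgroup.index_eq_zero_of_relIndex_eq_zero h)

theorem isPGroup_map_mk {Q : Subgroup P} (hQ : IsProPi {p} Q) (N : OpenNormalSubgroup P) :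
    IsPGroup p (Q.map (QuotientGroup.mk' (N : Subgroup P))) := by
  obtain ⟨n, hn⟩ := exists_relIndex_eq_pow hQ N
  refine IsPGroup.of_card (n := n) ?_
  rw [← hn, ← Subgroup.relIndex_ker, QuotientGroup.ker_mk']

variable [hp : Fact p.Prime]

/-- Sylow's theorem for profinite groups, by compactness from Sylow's theorem for the finite
continuous quotients. -/
theorem IsProfiniteSylow.exists_conj_mem {T : Subgroup P} (hT : IsProfiniteSylow p T)
    {Q : Subgroup P} (hQ : IsProPi {p} Q) : ∃ u : P, ∀ x ∈ Q, u⁻¹ * x * u ∈ T := by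
  let Z : OpenNormalSubgroup P → Set P := fun N =>
    {u | ∀ x ∈ Q, u⁻¹ * x * u ∈ T ⊔ (N : Subgroup P)}
  have hZc : ∀ N, IsClosed (Z N) := by
    intro N
    have : Z N = ⋂ x ∈ Q, (fun u => u⁻¹ * x * u) ⁻¹' (T ⊔ (N : Subgroup P) : Subgroup P) := by
      ext u; simp [Z]
    rw [this]
    refine isClosed_biInter fun x _ => IsClosed.preimage (by fun_prop) ?_
    exact Subgroup.isClosed_of_isOpen _ (Subgroup.isOpen_mono le_sup_right N.isOpen')
  have hZne : ∀ N, (Z N).Nonempty := by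
    intro N
    have : Finite (P ⧸ (N : Subgroup P)) := Subgroup.quotient_finite_of_isOpen _ N.isOpen'
    set f := QuotientGroup.mk' (N : Subgroup P) with hf
    have hfs : Function.Surjective f := QuotientGroup.mk'_surjective _
    have hcm : (T.map f).comap f = T ⊔ N := by
      rw [Subgroup.comap_map_eq, QuotientGroup.ker_mk']
    have hnd : ¬ p ∣ (T.map f).index := by
      rw [← Subgroup.index_comap_of_surjective _ hfs, hcm]
      exact hT.not_dvd N
    obtain ⟨R, hR⟩ := (isPGroup_map_mk hQ N).exists_le_sylow
    obtain ⟨g, hg⟩ := MulAction.exists_smul_eq (P ⧸ (N : Subgroup P))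
      ((isPGroup_map_mk hT.isProPi N).toSylow hnd) R
    obtain ⟨u, rfl⟩ := hfs g
    refine ⟨u, fun x hx => ?_⟩
    have h1 : f x ∈ (R : Subgroup (P ⧸ (N : Subgroup P))) := hR ⟨x, hx, rfl⟩
    rw [← hg, Sylow.coe_subgroup_smul, Subgroup.mem_pointwise_smul_iff_inv_smul_mem] at h1
    rw [← hcm]
    simpa only [MulAut.smul_def, ← map_inv, MulAut.conj_apply, inv_inv, ← map_mul,
      IsPGroup.toSylow_coe, Subgroup.mem_comap] using h1
  have hne : (⋂ N, Z N).Nonempty := by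
    have : Nonempty (OpenNormalSubgroup P) :=
      ⟨⟨⟨⊤, isOpen_univ⟩, inferInstanceAs (⊤ : Subgroup P).Normal⟩⟩
    refine IsCompact.nonempty_iInter_of_directed_nonempty_isCompact_isClosed Z (fun A B => ?_) hZne
      (fun N => (hZc N).isCompact) hZc
    refine ⟨A ⊓ B, fun u hu x hx => ?_, fun u hu x hx => ?_⟩
    · exact (sup_le_sup_left (fun y hy => hy.1 :
        ((A ⊓ B : OpenNormalSubgroup P) : Subgroup P) ≤ A) T) (hu x hx)
    · exact (sup_le_sup_left (fun y hy => hy.2 :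
        ((A ⊓ B : OpenNormalSubgroup P) : Subgroup P) ≤ B) T) (hu x hx)
  obtain ⟨u, hu⟩ := hne
  exact ⟨u, fun x hx => mem_of_forall_mem_sup hT.isClosed fun N => Set.mem_iInter.1 hu N x hx⟩

theorem IsProfiniteSylow.le_of_le {T T' : Subgroup P} (hT : IsProfiniteSylow p T)
    (hT' : IsProPi {p} T') (h : T ≤ T') : T' ≤ T := by
  refine fun x hx => mem_of_forall_mem_sup hT.isClosed fun N => ?_
  obtain ⟨n, hn⟩ := exists_relIndex_eq_pow hT' N
  have h1 : (T ⊔ (N : Subgroup P)).relIndex T' ∣ p ^ n :=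
    hn ▸ Subgroup.relIndex_dvd_of_le_left T' le_sup_right
  have h2 : ¬ p ∣ (T ⊔ (N : Subgroup P)).relIndex T' := by
    rw [← relIndex_sup_of_le T' (le_sup_right : (N : Subgroup P) ≤ T ⊔ N)]
    exact fun hd => hT.not_dvd N (hd.trans (Dvd.intro _
      (Subgroup.relIndex_mul_index (sup_le_sup_right h (N : Subgroup P)))))
  obtain ⟨k, -, hk⟩ := (Nat.dvd_prime_pow hp.out).1 h1
  have hk0 : k = 0 := by
    by_contra hk0
    exact h2 (hk ▸ dvd_pow_self p hk0)
  rw [hk0, pow_zero, Subgroup.relIndex_eq_one] at hk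
  exact hk hx

end Sylow

section Sylow

variable {P : Type*} [Group P] [TopologicalSpace P] [IsTopologicalGroup P] [CompactSpace P]
  [TotallyDisconnectedSpace P] {p : ℕ}

/-- If the Sylow subgroups are finite, the primes dividing the indices of the open subgroups of some
open normal subgroup are all different from `p`. -/
theorem IsProfiniteSylow.exists_not_dvd_of_finite {T : Subgroup P} (hT : IsProfiniteSylow p T)
    (hfin : Finite T) : ∃ N : OpenNormalSubgroup P, ∀ N' : OpenNormalSubgroup P, N' ≤ N →
      ¬ p ∣ (N' : Subgroup P).relIndex N := by
  have hcl : IsClosed ((T : Set P) \ {1}) := by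
    have : (T : Set P).Finite := hfin
    exact (this.subset Set.sdiff_subset).isClosed
  obtain ⟨N, hN⟩ := ProfiniteGrp.exist_openNormalSubgroup_sub_open_nhds_of_one
    hcl.isOpen_compl (by simp)
  have hcard : ∀ N' : OpenNormalSubgroup P, N' ≤ N →
      (N' : Subgroup P).index = Nat.card T * (T ⊔ (N' : Subgroup P)).index := by
    intro N' hN'
    have hbot : T ⊓ (N' : Subgroup P) = ⊥ := by
      refine (Subgroup.eq_bot_iff_forall _).2 fun x hx => ?_
      by_contra hx1
      exact hN (hN' hx.2) ⟨hx.1, hx1⟩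
    rw [← Subgroup.relIndex_mul_index (le_sup_right : (N' : Subgroup P) ≤ T ⊔ N'),
      Subgroup.relIndex_sup_right, ← Subgroup.inf_relIndex_left, hbot, Subgroup.relIndex_bot_left]
  refine ⟨N, fun N' hN' hd => hT.not_dvd N' (hd.trans ?_)⟩
  have h1 := Subgroup.relIndex_mul_index (show (N' : Subgroup P) ≤ N from hN')
  rw [hcard N' hN', hcard N le_rfl, mul_left_comm] at h1
  exact Dvd.intro _ (Nat.eq_of_mul_eq_mul_left Nat.card_pos h1)

end Sylow

/-! ### Sylow subgroups of compact subgroups -/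

section SylowOfCompact

variable {G : Type*} [Group G] [TopologicalSpace G] [IsTopologicalGroup G] [T2Space G]
  {p : ℕ} {U : Subgroup G}

theorem IsProPSylow.eq_of_le_conj {S T : Subgroup G} (hS : IsProPSylow p U S)
    (hTU : T ≤ U) (hT : IsProPi {p} T) {u : G} (hu : u ∈ U) (h : ∀ x ∈ S, u⁻¹ * x * u ∈ T) :
    T.map (MulAut.conj u).toMonoidHom = S := by
  refine hS.2.2 _ ?_ (hT.conj u) fun x hx => mem_map_conj_iff.2 (h x hx)
  rintro _ ⟨x, hx, rfl⟩
  exact U.mul_mem (U.mul_mem hu (hTU hx)) (U.inv_mem hu)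

variable [TotallyDisconnectedSpace G] [hp : Fact p.Prime]

theorem IsProfiniteSylow.isProPSylow_map [CompactSpace U]
    {T : Subgroup U} (hT : IsProfiniteSylow p T) : IsProPSylow p U (T.map U.subtype) := by
  refine ⟨?_, hT.isProPi.map continuous_subtype_val U.subtype_injective, fun T' hT'U hT' hle => ?_⟩
  · rintro _ ⟨x, -, rfl⟩; exact x.2
  refine le_antisymm (fun x hx => ?_) hle
  have := hT.le_of_le (hT'.comap (f := U.subtype) continuous_subtype_val U.subtype_injective)
    (Subgroup.map_le_iff_le_comap.1 hle)
  exact ⟨⟨x, hT'U hx⟩, this hx, rfl⟩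

variable (p) in
theorem exists_isProPSylow (hU : IsCompact (U : Set G)) : ∃ S : Subgroup G, IsProPSylow p U S := by
  have : CompactSpace U := isCompact_iff_compactSpace.1 hU
  obtain ⟨T, hT⟩ := exists_isProfiniteSylow (P := U) p
  exact ⟨_, hT.isProPSylow_map⟩

theorem IsProPSylow.exists_conj_mem (hU : IsCompact (U : Set G)) {S Q : Subgroup G}
    (hS : IsProPSylow p U S) (hQU : Q ≤ U) (hQ : IsProPi {p} Q) :
    ∃ u ∈ U, ∀ x ∈ Q, u⁻¹ * x * u ∈ S := by
  have : CompactSpace U := isCompact_iff_compactSpace.1 hU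
  obtain ⟨T, hT⟩ := exists_isProfiniteSylow (P := U) p
  have key : ∀ R : Subgroup G, R ≤ U → IsProPi {p} R →
      ∃ u ∈ U, ∀ x ∈ R, u⁻¹ * x * u ∈ T.map U.subtype := by
    intro R hRU hR
    obtain ⟨u, hu⟩ := hT.exists_conj_mem
      (hR.comap (f := U.subtype) continuous_subtype_val U.subtype_injective)
    exact ⟨u, u.2, fun x hx => ⟨_, hu ⟨x, hRU hx⟩ hx, rfl⟩⟩
  obtain ⟨v, hv, hvS⟩ := key S hS.1 hS.2.1
  obtain ⟨w, hw, hwQ⟩ := key Q hQU hQ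
  have heq := hS.eq_of_le_conj (hT.isProPSylow_map).1 (hT.isProPSylow_map).2.1 hv hvS
  refine ⟨w * v⁻¹, U.mul_mem hw (U.inv_mem hv), fun x hx => ?_⟩
  rw [← heq, mem_map_conj_iff]
  simpa [mul_assoc] using hwQ x hx

end SylowOfCompact

/-! ### Localizations at Sylow subgroups -/

section Conj

variable {G : Type*} [Group G]

theorem mem_toConjAct_smul {S : Subgroup G} {g x : G} :
    x ∈ ConjAct.toConjAct g • S ↔ g⁻¹ * x * g ∈ S := by
  rw [Subgroup.mem_pointwise_smul_iff_inv_smul_mem]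
  simp [ConjAct.smul_def]

variable [TopologicalSpace G] [IsTopologicalGroup G]

theorem isOpen_toConjAct_smul {W : Subgroup G} (hW : IsOpen (W : Set G)) (g : G) :
    IsOpen ((ConjAct.toConjAct g • W : Subgroup G) : Set G) := by
  have : ((ConjAct.toConjAct g • W : Subgroup G) : Set G) = (fun x => g⁻¹ * x * g) ⁻¹' W := by
    ext x; exact mem_toConjAct_smul
  rw [this]
  exact hW.preimage (by fun_prop)

theorem IsProPi.toConjAct_smul [T2Space G] {π : Set ℕ} {S : Subgroup G} (hS : IsProPi π S)
    (g : G) : IsProPi π (ConjAct.toConjAct g • S : Subgroup G) := by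
  have : ConjAct.toConjAct g • S = S.map (MulAut.conj g).toMonoidHom := by
    ext x; rw [mem_toConjAct_smul, mem_map_conj_iff]
  exact this ▸ hS.conj g

theorem relIndex_ne_zero_of_isOpen_of_isCompact {V A : Subgroup G} (hV : IsOpen (V : Set G))
    (hA : IsCompact (A : Set G)) : V.relIndex A ≠ 0 := by
  have : CompactSpace A := isCompact_iff_compactSpace.1 hA
  exact index_ne_zero_of_isOpen (hV.preimage continuous_subtype_val)

end Conj

section Sylow

variable {G : Type*} [Group G] [TopologicalSpace G] [IsTopologicalGroup G] [T2Space G]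
  {p : ℕ} {U S : Subgroup G}

/-- If the Sylow subgroup `T` of a compact open subgroup `V` is contained in a conjugate of the
pro-`p` group `S`, then it is commensurable to that conjugate. -/
theorem IsProPSylow.commensurable_of_le_conj {V T : Subgroup G} (hV : IsOpen (V : Set G))
    (hT : IsProPSylow p V T) (hS : IsProPi {p} S) {g : G} (h : ∀ x ∈ T, g⁻¹ * x * g ∈ S) :
    Subgroup.Commensurable T (ConjAct.toConjAct g • S) := by
  have hSg := hS.toConjAct_smul g
  have hle : T ≤ ConjAct.toConjAct g • S := fun x hx => mem_toConjAct_smul.2 (h x hx)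
  have heq : V ⊓ ConjAct.toConjAct g • S = T :=
    hT.2.2 _ inf_le_left (hSg.of_le ((V.isClosed_of_isOpen hV).inter hSg.isCompact.isClosed)
      inf_le_right) (le_inf hT.1 hle)
  refine ⟨?_, by rw [Subgroup.relIndex_eq_one.2 hle]; exact one_ne_zero⟩
  rw [← heq, Subgroup.inf_relIndex_right]
  exact relIndex_ne_zero_of_isOpen_of_isCompact hV hSg.isCompact

variable [TotallyDisconnectedSpace G] [hp : Fact p.Prime]

theorem IsProPSylow.inf_of_normalized (hU : IsCompact (U : Set G)) (hS : IsProPSylow p U S)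
    {N : Subgroup G} (hN : IsCompact (N : Set G)) (hNU : N ≤ U)
    (hUN : ∀ u ∈ U, ∀ x ∈ N, u * x * u⁻¹ ∈ N) : IsProPSylow p N (S ⊓ N) := by
  obtain ⟨T, hT⟩ := exists_isProPSylow p hN
  obtain ⟨u, hu, huT⟩ := hS.exists_conj_mem hU (hT.1.trans hNU) hT.2.1
  refine ⟨inf_le_right, hS.2.1.of_le (hS.2.1.isCompact.isClosed.inter hN.isClosed) inf_le_left,
    fun R hRN hR hle => le_antisymm (fun x hx => ?_) hle⟩
  have hRT := hT.2.2 (R.map (MulAut.conj u).toMonoidHom) (by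
    rintro _ ⟨y, hy, rfl⟩
    exact hUN u hu y (hRN hy)) (hR.conj u) (fun y hy => mem_map_conj_iff.2 (hle ⟨huT y hy, by
      simpa using hUN u⁻¹ (U.inv_mem hu) y (hT.1 hy)⟩))
  have hxT : u * x * u⁻¹ ∈ T := hRT ▸ ⟨x, hx, rfl⟩
  exact ⟨by simpa [mul_assoc] using huT _ hxT, hRN hx⟩

/-- The commensurator of a Sylow subgroup of a compact open subgroup `U` is dense: it meets
`N g N` for each open normal subgroup `N` of `U`, since a Sylow subgroup of `N ∩ g N g⁻¹` is
commensurable both to an `N`-conjugate of `S` and to a `g N`-conjugate of `S`. -/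
theorem IsProPSylow.dense_commensurator [LocallyCompactSpace G] (hUo : IsOpen (U : Set G))
    (hU : IsCompact (U : Set G)) (hS : IsProPSylow p U S) :
    Dense (Subgroup.Commensurable.commensurator S : Set G) := by
  intro g
  rw [mem_closure_iff_nhds]
  intro O hO
  have ht : Filter.Tendsto (fun z : G × G => z.1 * g * z.2) (𝓝 1 ×ˢ 𝓝 1) (𝓝 g) := by
    have : Continuous fun z : G × G => z.1 * g * z.2 := by fun_prop
    have := this.tendsto (1, 1)
    rwa [nhds_prod_eq, one_mul, mul_one] at this
  obtain ⟨A, hA, hAO⟩ := Filter.mem_prod_same_iff.1 (ht hO)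
  obtain ⟨N, hNo, hNc, hNA, hUN⟩ := exists_compact_open_subgroup_normalized hU
    (Filter.inter_mem hA (hUo.mem_nhds U.one_mem))
  have hSN := hS.inf_of_normalized hU hNc (fun x hx => (hNA hx).2) hUN
  set V := N ⊓ ConjAct.toConjAct g • N with hV
  have hVo : IsOpen (V : Set G) := hNo.inter (isOpen_toConjAct_smul hNo g)
  have hVc : IsCompact (V : Set G) :=
    hNc.of_isClosed_subset (V.isClosed_of_isOpen hVo) Set.inter_subset_left
  obtain ⟨T, hT⟩ := exists_isProPSylow p hVc
  obtain ⟨a, ha, haT⟩ := hSN.exists_conj_mem hNc (hT.1.trans inf_le_left) hT.2.1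
  obtain ⟨b, hb, hbT⟩ := hSN.exists_conj_mem hNc (Q := T.map (MulAut.conj g⁻¹).toMonoidHom)
    (by
      rintro _ ⟨x, hx, rfl⟩
      simpa using mem_toConjAct_smul.1 (hT.1 hx).2) (hT.2.1.conj g⁻¹)
  have h1 := hT.commensurable_of_le_conj hVo hS.2.1 (g := a) fun x hx => (haT x hx).1
  have h2 := hT.commensurable_of_le_conj hVo hS.2.1 (g := g * b) fun x hx => by
    have := (hbT _ ⟨x, hx, rfl⟩).1
    simpa [mul_assoc] using this
  have h3 := (Subgroup.Commensurable.commensurable_conj (ConjAct.toConjAct a⁻¹)).1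
    (h2.symm.trans h1)
  rw [smul_smul, smul_smul, ← map_mul, ← map_mul, inv_mul_cancel, map_one, one_smul] at h3
  refine ⟨a⁻¹ * (g * b), ?_, (Subgroup.Commensurable.commensurator_mem_iff _ _).2 h3⟩
  have := hAO (Set.mk_mem_prod (hNA (N.inv_mem ha)).1 (hNA hb).1)
  simpa [mul_assoc] using this

end Sylow

section Localized

variable {G : Type u} [Group G] [TopologicalSpace G] [IsTopologicalGroup G]
  {S : Subgroup G}

theorem LocalizedAt.not_discreteTopology [hc : CompactSpace S] [hinf : Infinite S] :
    ¬ DiscreteTopology (LocalizedAt S) := by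
  intro h
  have := (LocalizedAt.isOpenEmbedding_ofSubgroup S).isEmbedding.discreteTopology
  exact not_finite_iff_infinite.2 hinf finite_of_compact_of_discrete

variable [T2Space G]

theorem LocalizedAt.isLocallyProPi {π : Set ℕ} (hS : IsProPi π S) :
    IsLocallyProPi π (LocalizedAt S) := by
  have := hS.compactSpace
  have := LocalizedAt.isTopologicalGroup (K := S) hS.isCompact.isClosed
  have he := LocalizedAt.isOpenEmbedding_ofSubgroup S
  have : CompactSpace (LocalizedAt.ofSubgroup S).range :=
    isCompact_iff_compactSpace.1 (isCompact_range he.continuous)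
  refine ⟨(LocalizedAt.ofSubgroup S).range, he.isOpen_range, ?_⟩
  let f : (LocalizedAt.ofSubgroup S).range →* S :=
    ((LocalizedAt.incl S).comp (LocalizedAt.ofSubgroup S).range.subtype).codRestrict S (by
      rintro ⟨_, k, rfl⟩
      exact k.2)
  refine hS.of_injective (f := f) ?_ fun x y h => ?_
  · exact ((LocalizedAt.continuous_incl S).comp continuous_subtype_val).subtype_mk _
  · exact Subtype.ext (LocalizedAt.incl_injective S (congrArg (fun z : S => (z : G)) h))

theorem IsProPSylow.isDenseGroupEmbedding [LocallyCompactSpace G] [TotallyDisconnectedSpace G]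
    {p : ℕ} [hp : Fact p.Prime] {U : Subgroup G} (hUo : IsOpen (U : Set G))
    (hU : IsCompact (U : Set G)) (hS : IsProPSylow p U S) :
    IsDenseGroupEmbedding (LocalizedAt.incl S) := by
  have := hS.2.1.compactSpace
  have := LocalizedAt.isTopologicalGroup (K := S) hS.2.1.isCompact.isClosed
  have he := LocalizedAt.isOpenEmbedding_ofSubgroup S
  refine ⟨‹_›, T2Space.of_injective_continuous (LocalizedAt.incl_injective S)
    (LocalizedAt.continuous_incl S), ?_, LocalizedAt.continuous_incl S,
    LocalizedAt.incl_injective S, ?_⟩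
  · exact (isCompact_range he.continuous).locallyCompactSpace_of_mem_nhds_of_group (x := 1)
      (he.isOpen_range.mem_nhds ⟨1, map_one _⟩)
  · have hr : Set.range (LocalizedAt.incl S) = Subgroup.Commensurable.commensurator S :=
      Subtype.range_coe
    rw [DenseRange, hr]
    exact hS.dense_commensurator hUo hU

end Localized

/-! ### The local prime content -/

section PrimeContent

variable {G : Type*} [Group G] [TopologicalSpace G] [IsTopologicalGroup G]

/-- If `F` moves `W` to conjugates meeting `W` in subgroups of index at most `m`, then the
intersection of finitely many conjugates of `W` by elements of `⟨F⟩` contains an open subgroup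
whose index in `W` has no prime factor above `m`: intersect successively along words in `F`. -/
theorem exists_smooth_subgroup {W : Subgroup G} (hWo : IsOpen (W : Set G))
    (hWc : IsCompact (W : Set G)) {F : Set G} {m : ℕ}
    (hm : ∀ f ∈ F ∪ F⁻¹, (ConjAct.toConjAct f • W).relIndex W ≤ m) (t : Finset G)
    (ht : ∀ d ∈ t, d ∈ Subgroup.closure F) :
    ∃ B : Subgroup G, IsOpen (B : Set G) ∧ B ≤ W ∧
      (∀ q : ℕ, q.Prime → q ∣ B.relIndex W → q ≤ m) ∧ ∀ d ∈ t, B ≤ ConjAct.toConjAct d • W := by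
  have step : ∀ d ∈ Subgroup.closure F, ∀ B : Subgroup G, IsOpen (B : Set G) → B ≤ W →
      (∀ q : ℕ, q.Prime → q ∣ B.relIndex W → q ≤ m) →
      ∃ B' ≤ B, IsOpen (B' : Set G) ∧ (∀ q : ℕ, q.Prime → q ∣ B'.relIndex W → q ≤ m) ∧
        B' ≤ ConjAct.toConjAct d • W := by
    intro d hd B hBo hBW hB
    have key : ∀ x y : G, y ∈ F ∪ F⁻¹ →
        (∃ B' ≤ B, IsOpen (B' : Set G) ∧ (∀ q : ℕ, q.Prime → q ∣ B'.relIndex W → q ≤ m) ∧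
          B' ≤ ConjAct.toConjAct x • W) →
        ∃ B' ≤ B, IsOpen (B' : Set G) ∧ (∀ q : ℕ, q.Prime → q ∣ B'.relIndex W → q ≤ m) ∧
          B' ≤ ConjAct.toConjAct (x * y) • W := by
      rintro x y hy ⟨B', hB'B, hB'o, hB', hB'x⟩
      refine ⟨B' ⊓ ConjAct.toConjAct (x * y) • W, inf_le_left.trans hB'B,
        hB'o.inter (isOpen_toConjAct_smul hWo _), fun q hq hqd => ?_, inf_le_right⟩
      rw [← Subgroup.relIndex_mul_relIndex _ B' W inf_le_left (hB'B.trans hBW), hq.dvd_mul,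
        Subgroup.inf_relIndex_left] at hqd
      rcases hqd with hqd | hqd
      · have h1 : (ConjAct.toConjAct (x * y) • W).relIndex (ConjAct.toConjAct x • W) =
            (ConjAct.toConjAct y • W).relIndex W := by
          rw [map_mul, mul_smul, Subgroup.relIndex_pointwise_smul]
        have hne : (ConjAct.toConjAct (x * y) • W).relIndex (ConjAct.toConjAct x • W) ≠ 0 := by
          rw [h1]
          exact relIndex_ne_zero_of_isOpen_of_isCompact (isOpen_toConjAct_smul hWo _) hWc
        have h2 := Subgroup.relIndex_le_of_le_right hB'x hne
        have hne' : (ConjAct.toConjAct (x * y) • W).relIndex B' ≠ 0 := fun h =>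
          hne (Subgroup.relIndex_eq_zero_of_le_right hB'x h)
        exact (Nat.le_of_dvd (Nat.pos_of_ne_zero hne') hqd).trans (h2.trans (h1 ▸ hm y hy))
      · exact hB' q hq hqd
    induction hd using Subgroup.closure_induction_right with
    | one => exact ⟨B, le_rfl, hBo, hB, by simpa using hBW⟩
    | mul_right x hx y hy ih => exact key x y (Or.inl hy) ih
    | mul_inv_cancel x hx y hy ih => exact key x y⁻¹ (Or.inr (by simpa using hy)) ih
  classical
  induction t using Finset.induction_on with
  | empty =>
    refine ⟨W, hWo, le_rfl, fun q hq h => ?_, by simp⟩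
    rw [Subgroup.relIndex_self] at h
    exact absurd (Nat.dvd_one.1 h) hq.ne_one
  | insert d t hdt ih =>
    obtain ⟨B, hBo, hBW, hB, hBt⟩ := ih fun d hd => ht d (Finset.mem_insert_of_mem hd)
    obtain ⟨B', hB'B, hB'o, hB', hB'd⟩ := step d (ht d (Finset.mem_insert_self d t)) B hBo hBW hB
    refine ⟨B', hB'o, hB'B.trans hBW, hB', fun e he => ?_⟩
    rcases Finset.mem_insert.1 he with rfl | he
    · exact hB'd
    · exact hB'B.trans (hBt e he)

/-- The compact open subgroup of an expansive pair is pro-`π` for a finite set `π`. -/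
theorem IsExpansivePair.exists_isProPi [T2Space G] [TotallyDisconnectedSpace G]
    {W : Subgroup G} {F : Set G} (h : IsExpansivePair W F) (hF : F.Finite)
    (hWo : IsOpen (W : Set G)) (hWc : IsCompact (W : Set G)) :
    ∃ π : Set ℕ, π.Finite ∧ IsProPi π W := by
  obtain ⟨m, hm⟩ := ((hF.union hF.inv).image
    fun f => (ConjAct.toConjAct f • W).relIndex W).bddAbove
  have hm' : ∀ f ∈ F ∪ F⁻¹, (ConjAct.toConjAct f • W).relIndex W ≤ m :=
    fun f hf => hm ⟨f, hf, rfl⟩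
  refine ⟨{q | q ≤ m}, Set.finite_le_nat m, inferInstance, inferInstance,
    isCompact_iff_compactSpace.1 hWc, inferInstance, fun N _ hNo q hq hqN => ?_⟩
  have hNo' : IsOpen (N.map W.subtype : Set G) := hWo.isOpenMap_subtype_val _ hNo
  obtain ⟨t, ht⟩ := exists_inter_subset_of_directed hWc hNo'
    (fun t : Finset (Subgroup.closure F) =>
      ⋂ d ∈ t, ((ConjAct.toConjAct (d : G) • W : Subgroup G) : Set G))
    (fun t => isClosed_biInter fun d _ => Subgroup.isClosed_of_isOpen _
      (isOpen_toConjAct_smul hWo _))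
    (fun s t => by
      classical
      exact ⟨s ∪ t, Set.biInter_subset_biInter_left fun d hd => Finset.mem_union_left _ hd,
        Set.biInter_subset_biInter_left fun d hd => Finset.mem_union_right _ hd⟩) (by
    rintro x ⟨-, hx⟩
    have : x = 1 := h x fun d hd => by
      have := Set.mem_iInter₂.1 (Set.mem_iInter.1 hx {⟨d, hd⟩}) _ (Finset.mem_singleton_self _)
      exact mem_toConjAct_smul.1 this
    rw [this]
    exact one_mem _)
  classical
  obtain ⟨B, -, hBW, hB, hBt⟩ := exists_smooth_subgroup hWo hWc hm' (t.image Subtype.val)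
    (fun d hd => by
      obtain ⟨e, -, rfl⟩ := Finset.mem_image.1 hd
      exact e.2)
  refine hB q hq (hqN.trans ?_)
  have hBN : B ≤ N.map W.subtype := fun x hx => ht ⟨hBW hx, Set.mem_iInter₂.2 fun d hd =>
    hBt d (Finset.mem_image_of_mem _ hd) hx⟩
  have hNi : (N.map W.subtype).relIndex W = N.index := by
    rw [Subgroup.relIndex, Subgroup.subgroupOf,
      Subgroup.comap_map_eq_self_of_injective W.subtype_injective]
  exact hNi ▸ Subgroup.relIndex_dvd_of_le_left W hBN

variable [T2Space G]

theorem exists_infinite_isProPi_le {π : Set ℕ} {P : Subgroup G} (hinf : Infinite P)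
    (hP : IsProPi π P) {U : Subgroup G} (hU : IsOpen (U : Set G)) :
    ∃ Q ≤ U, Infinite Q ∧ IsProPi π Q := by
  refine ⟨P ⊓ U, inf_le_right, ?_, hP.of_le
    (hP.isCompact.isClosed.inter (U.isClosed_of_isOpen hU)) inf_le_left⟩
  by_contra h
  rw [not_infinite_iff_finite] at h
  have h1 : Finite (U.subgroupOf P) := by
    refine Finite.of_injective (fun x : U.subgroupOf P => (⟨x, x.1.2, x.2⟩ : (P ⊓ U : Subgroup G)))
      fun x y hxy => ?_
    exact Subtype.ext (Subtype.ext (congrArg (fun z : (P ⊓ U : Subgroup G) => (z : G)) hxy))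
  exact not_finite_iff_infinite.2 hinf ((Subgroup.finite_iff_finite_and_finiteIndex _).2
    ⟨h1, ⟨relIndex_ne_zero_of_isOpen_of_isCompact hU hP.isCompact⟩⟩)

theorem localPrimeContent_subset {π : Set ℕ} (h : IsLocallyProPi π G) :
    localPrimeContent G ⊆ π := by
  rintro p ⟨-, P, hinf, hP⟩
  obtain ⟨U, hU, hUπ⟩ := h
  obtain ⟨Q, hQU, hQ, hQp⟩ := exists_infinite_isProPi_le hinf hP hU
  exact hQp.mem_of_infinite (hUπ.of_le hQp.isCompact.isClosed hQU) hQ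

/-- For each of the finitely many primes `q ∈ π` outside the local prime content, the Sylow
`q`-subgroups are finite, so some open normal subgroup avoids `q`. -/
theorem isLocallyProPi_localPrimeContent {π : Set ℕ} (hπ : π.Finite) (h : IsLocallyProPi π G) :
    IsLocallyProPi (localPrimeContent G) G := by
  obtain ⟨U, hUo, hU⟩ := h
  obtain ⟨_, _, _, _, hUπ⟩ := id hU
  have hex : ∀ q : ℕ, q.Prime → q ∉ localPrimeContent G → ∃ N : OpenNormalSubgroup U,
      ∀ N' : OpenNormalSubgroup U, N' ≤ N → ¬ q ∣ (N' : Subgroup U).relIndex N := by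
    intro q hq hqG
    have : Fact q.Prime := ⟨hq⟩
    obtain ⟨T, hT⟩ := exists_isProfiniteSylow (P := U) q
    refine hT.exists_not_dvd_of_finite ?_
    by_contra hinf
    rw [not_finite_iff_infinite] at hinf
    refine hqG ⟨hq, T.map U.subtype, ?_, hT.isProPi.map continuous_subtype_val U.subtype_injective⟩
    exact (T.equivMapOfInjective U.subtype U.subtype_injective).toEquiv.infinite_iff.1 hinf
  have : Nonempty (OpenNormalSubgroup U) :=
    ⟨⟨⟨⊤, isOpen_univ⟩, inferInstanceAs (⊤ : Subgroup U).Normal⟩⟩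
  choose! N hN using hex
  let s : Set ℕ := {q ∈ π | q.Prime ∧ q ∉ localPrimeContent G}
  have hs : s.Finite := hπ.subset fun q hq => hq.1
  let M : Subgroup U := ⨅ q ∈ s, (N q : Subgroup U)
  have hMo : IsOpen (M : Set U) := by
    simp only [M, Subgroup.coe_iInf]
    exact hs.isOpen_biInter fun q _ => (N q).isOpen'
  have hM : IsProPi (localPrimeContent G) M := by
    refine (isProPi_subgroup_iff (M.isClosed_of_isOpen hMo)).2 fun N' q hq hqN => ?_
    by_contra hqG
    have hqπ : q ∈ π := hUπ N' inferInstance N'.isOpen' q hq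
      (hqN.trans (Subgroup.relIndex_dvd_index_of_normal _ _))
    have hMN : M ≤ (N q : Subgroup U) := iInf₂_le q ⟨hqπ, hq, hqG⟩
    refine hN q hq hqG (N' ⊓ N q) inf_le_right (hqN.trans ?_)
    refine Dvd.dvd.trans ?_ (relIndex_dvd_relIndex_of_normal hMN)
    exact Subgroup.relIndex_dvd_of_le_left M
      (show ((N' ⊓ N q : OpenNormalSubgroup U) : Subgroup U) ≤ N' from fun x hx => hx.1)
  exact ⟨M.map U.subtype, hUo.isOpenMap_subtype_val _ hMo,
    hM.map continuous_subtype_val U.subtype_injective⟩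

/-- A non-discrete locally pro-`p` group that embeds continuously witnesses `p ∈ η(G)`. -/
theorem mem_localPrimeContent_of_injective {H : Type*} [Group H] [TopologicalSpace H]
    [IsTopologicalGroup H] [T2Space H] {ψ : H →* G} (hψ : Continuous ψ)
    (hinj : Function.Injective ψ) (hd : ¬ DiscreteTopology H) {p : ℕ} (hp : p.Prime)
    (h : IsLocallyProPi {p} H) : p ∈ localPrimeContent G := by
  obtain ⟨U, hU, hUp⟩ := h
  refine ⟨hp, U.map ψ, ?_, hUp.map hψ hinj⟩
  refine (U.equivMapOfInjective ψ hinj).toEquiv.infinite_iff.1 ?_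
  by_contra hfin
  exact hd (discreteTopology_of_finite_open hU (not_infinite_iff_finite.1 hfin))

theorem IsProPSylow.infinite [TotallyDisconnectedSpace G] {p : ℕ} (hp : p ∈ localPrimeContent G)
    {U S : Subgroup G} (hUo : IsOpen (U : Set G)) (hU : IsCompact (U : Set G))
    (hS : IsProPSylow p U S) : Infinite S := by
  have : Fact p.Prime := ⟨hp.1⟩
  obtain ⟨-, P, hinf, hP⟩ := hp
  obtain ⟨Q, hQU, hQ, hQp⟩ := exists_infinite_isProPi_le hinf hP hUo
  obtain ⟨u, -, huQ⟩ := hS.exists_conj_mem hU hQU hQp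
  refine Infinite.of_injective (fun x : Q => (⟨u⁻¹ * x * u, huQ x x.2⟩ : S)) fun x y hxy => ?_
  have := congrArg (fun z : S => (z : G)) hxy
  exact Subtype.ext (by simpa using this)

end PrimeContent

theorem IsRegionallyExpansive.localPrimeContent_finite_and_isLocallyProPi {G : Type*} [Group G]
    [TopologicalSpace G] (hG : IsTDLC G) (he : IsRegionallyExpansive G) :
    (localPrimeContent G).Finite ∧ IsLocallyProPi (localPrimeContent G) G := by
  obtain ⟨_, _, _, _⟩ := hG
  obtain ⟨W, F, hWo, hWc, hF, hWF⟩ := he.exists_isExpansivePair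
  obtain ⟨π, hπ, hWπ⟩ := hWF.exists_isProPi hF hWo hWc
  have h : IsLocallyProPi π G := ⟨W, hWo, hWπ⟩
  exact ⟨hπ.subset (localPrimeContent_subset h), isLocallyProPi_localPrimeContent hπ h⟩

theorem IsLocallyProPi.subgroup {G : Type*} [Group G] [TopologicalSpace G] [IsTopologicalGroup G]
    {π : Set ℕ} (h : IsLocallyProPi π G) {N : Subgroup G} (hN : IsClosed (N : Set G)) :
    IsLocallyProPi π N := by
  obtain ⟨U, hU, hUπ⟩ := h
  have := hUπ.compactSpace
  refine ⟨U.subgroupOf N, hU.preimage continuous_subtype_val, ?_⟩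
  have hc : IsCompact ((U.subgroupOf N : Subgroup N) : Set N) :=
    hN.isClosedEmbedding_subtypeVal.isCompact_preimage hUπ.isCompact
  have : CompactSpace (U.subgroupOf N) := isCompact_iff_compactSpace.1 hc
  refine hUπ.of_injective (f := N.subtype.subgroupComap U)
    ((continuous_subtype_val.comp continuous_subtype_val).subtype_mk _) fun x y h => ?_
  exact Subtype.ext (Subtype.ext (congrArg (fun z : U => (z : G)) h))

theorem IsRobustlyMonolithic.monolithIsSimpleDenseProP {G : Type u} [Group G]
    [TopologicalSpace G] (hG : IsRobustlyMonolithic G) {H : Type v} [Group H] [TopologicalSpace H]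
    {ψ : H →* G} (hψ : IsDenseGroupEmbedding ψ) (hd : ¬ DiscreteTopology H) {p : ℕ}
    (hp : IsLocallyProPi {p} H) : MonolithIsSimpleDenseProP p ψ := by
  obtain ⟨hH, φ, hφ, hφd⟩ := hG.of_isDenseGroupEmbedding hψ hd
  have := hψ.isTopologicalGroup
  exact ⟨hH.not_discrete, hH.isTopologicallySimple, hp.subgroup isClosed_monolith, φ, hφ, hφd⟩

theorem IsProPSylow.localizedAt {G : Type u} [Group G] [TopologicalSpace G] (hG : IsTDLC G)
    {p : ℕ} (hp : p ∈ localPrimeContent G) {U S : Subgroup G} (hUo : IsOpen (U : Set G))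
    (hU : IsCompact (U : Set G)) (hS : IsProPSylow p U S) :
    IsDenseGroupEmbedding (LocalizedAt.incl S) ∧ ¬ DiscreteTopology (LocalizedAt S) ∧
      IsLocallyProPi {p} (LocalizedAt S) := by
  obtain ⟨_, _, _, _⟩ := hG
  have : Fact p.Prime := ⟨hp.1⟩
  have := hS.2.1.compactSpace
  have := hS.infinite hp hUo hU
  exact ⟨hS.isDenseGroupEmbedding hUo hU, LocalizedAt.not_discreteTopology,
    LocalizedAt.isLocallyProPi hS.2.1⟩

end TDLC

theorem mainTheorem3 :
    (∀ (G : Type u) [Group G] [TopologicalSpace G], IsTDLC G → IsRegionallyExpansive G →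
      (localPrimeContent G).Finite ∧ IsLocallyProPi (localPrimeContent G) G ∧
      ∀ p ∈ localPrimeContent G, ∀ U : Subgroup G, IsOpen (U : Set G) → IsCompact (U : Set G) →
        (∃ P : Subgroup G, P ≤ U ∧ Infinite P ∧ IsProPi {p} P) ∧
        (∃ S : Subgroup G, IsProPSylow p U S) ∧
        ∀ S : Subgroup G, IsProPSylow p U S → ¬ DiscreteTopology (LocalizedAt S)) ∧
    (∀ (G : Type u) [Group G] [TopologicalSpace G], IsRobustlyMonolithic G →
      ((localPrimeContent G).Finite ∧ IsLocallyProPi (localPrimeContent G) G) ∧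
      (∀ p ∈ localPrimeContent G, ∀ U : Subgroup G, IsOpen (U : Set G) → IsCompact (U : Set G) →
        (∃ S : Subgroup G, IsProPSylow p U S) ∧
        ∀ S : Subgroup G, IsProPSylow p U S →
          IsDenseGroupEmbedding (LocalizedAt.incl S) ∧
          ¬ DiscreteTopology (LocalizedAt S) ∧
          IsLocallyProPi {p} (LocalizedAt S) ∧
          IsRobustlyMonolithic (LocalizedAt S) ∧
          MonolithIsSimpleDenseProP p (LocalizedAt.incl S)) ∧
      (∀ π : Set ℕ,
        (π.Finite ∧ (∀ p ∈ π, p.Prime) ∧ IsLocallyProPi π G ∧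
          ∀ p ∈ π, ∃ (H : Type u) (_ : Group H) (_ : TopologicalSpace H) (ψ : H →* G),
            IsDenseGroupEmbedding ψ ∧ ¬ DiscreteTopology H ∧ IsLocallyProPi {p} H) ↔
        π = localPrimeContent G) ∧
      (∀ p ∈ localPrimeContent G, ∀ (H : Type v) [Group H] [TopologicalSpace H] (ψ : H →* G),
        IsDenseGroupEmbedding ψ → ¬ DiscreteTopology H → IsLocallyProPi {p} H →
          IsRobustlyMonolithic H ∧ MonolithIsSimpleDenseProP p ψ) ∧
      (IsTopologicallySimple G → ∀ p ∈ localPrimeContent G,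
        ∃ (H : Type u) (_ : Group H) (_ : TopologicalSpace H) (ψ : H →* G),
          IsDenseGroupEmbedding ψ ∧ ¬ DiscreteTopology H ∧ IsTopologicallySimple H ∧
          IsLocallyProPi {p} H)) := by
  refine ⟨fun G _ _ hG he => ?_, fun G _ _ hG => ?_⟩
  · have hη := he.localPrimeContent_finite_and_isLocallyProPi hG
    refine ⟨hη.1, hη.2, fun p hp U hUo hU => ?_⟩
    have : Fact p.Prime := ⟨hp.1⟩
    have hloc := fun S => IsProPSylow.localizedAt (S := S) hG hp hUo hU
    obtain ⟨_, _, _, _⟩ := hG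
    obtain ⟨-, P, hinf, hP⟩ := hp
    exact ⟨exists_infinite_isProPi_le hinf hP hUo, exists_isProPSylow p hU,
      fun S hS => (hloc S hS).2.1⟩
  · have hη := hG.isRegionallyExpansive_self.localPrimeContent_finite_and_isLocallyProPi hG.isTDLC
    obtain ⟨_, _, _, _⟩ := id hG.isTDLC
    have hloc : ∀ p ∈ localPrimeContent G, ∃ S : Subgroup G,
        IsDenseGroupEmbedding (LocalizedAt.incl S) ∧ ¬ DiscreteTopology (LocalizedAt S) ∧
          IsLocallyProPi {p} (LocalizedAt S) := by
      intro p hp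
      have : Fact p.Prime := ⟨hp.1⟩
      obtain ⟨U, hUo, hU, -⟩ := exists_compact_open_subgroup_subset (G := G) Filter.univ_mem
      obtain ⟨S, hS⟩ := exists_isProPSylow p hU
      exact ⟨S, hS.localizedAt hG.isTDLC hp hUo hU⟩
    refine ⟨hη, fun p hp U hUo hU => ?_, fun π => ⟨?_, ?_⟩, fun p hp H _ _ ψ hψ hd hH =>
      ⟨(hG.of_isDenseGroupEmbedding hψ hd).1, hG.monolithIsSimpleDenseProP hψ hd hH⟩,
      fun hs p hp => ?_⟩
    · have : Fact p.Prime := ⟨hp.1⟩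
      refine ⟨exists_isProPSylow p hU, fun S hS => ?_⟩
      obtain ⟨h1, h2, h3⟩ := hS.localizedAt hG.isTDLC hp hUo hU
      exact ⟨h1, h2, h3, (hG.of_isDenseGroupEmbedding h1 h2).1,
        hG.monolithIsSimpleDenseProP h1 h2 h3⟩
    · rintro ⟨-, hprime, hπ, hH⟩
      refine Set.Subset.antisymm (fun p hp => ?_) (localPrimeContent_subset hπ)
      obtain ⟨H, _, _, ψ, hψ, hd, hHp⟩ := hH p hp
      have := hψ.isTopologicalGroup
      have := hψ.t2Space
      exact mem_localPrimeContent_of_injective hψ.continuous hψ.injective hd (hprime p hp) hHp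
    · rintro rfl
      refine ⟨hη.1, fun p hp => hp.1, hη.2, fun p hp => ?_⟩
      obtain ⟨S, hS⟩ := hloc p hp
      exact ⟨LocalizedAt S, _, _, LocalizedAt.incl S, hS⟩
    · obtain ⟨S, h1, h2, h3⟩ := hloc p hp
      obtain ⟨h4, h5, h6, φ, -, hφ⟩ := hG.monolithIsSimpleDenseProP h1 h2 h3
      refine ⟨monolith (LocalizedAt S), _, _, (monolith G).subtype.comp φ, ?_, h4, h5, h6⟩
      refine ⟨hφ.isTopologicalGroup, hφ.t2Space, hφ.locallyCompactSpace,
        continuous_subtype_val.comp hφ.continuous,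
        (monolith G).subtype_injective.comp hφ.injective, ?_⟩
      refine DenseRange.comp (g := (monolith G).subtype) (Function.Surjective.denseRange fun x => ?_)
        hφ.denseRange continuous_subtype_val
      exact ⟨⟨x, by rw [hs.monolith_eq_top]; exact Subgroup.mem_top x⟩, rfl⟩
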